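/- **Setting.** Let $n\ge 2$, $m\ge 1$, $k\ge 2$ be integers and $\varepsilon\in(0,1)$ with $m\le n^{(1-\varepsilon)k/2}$. *Shapes.* A *shape* $\alpha$ is a finite bipartite graph without multi-edges, with vertex set $V(\alpha)$ consisting of *square* and *circle* vertices, with edges joining a square to a circle and carrying a positive integer label $l(e)$, together with two sets $U_\alpha,V_\alpha\subseteq V(\alpha)$ of squares (the left and right index). Put $w(E(\alpha))=\sum_e l(e)$ and $\lambda_\alpha=n^{-w(E(\alpha))/2}$. The degree $\deg_\alpha(v)$ is the sum of the labels of the edges at $v$; the total degree of a square $v$ is $\deg_\alpha(v)+1_{v\in U_\alpha}+1_{v\in V_\alpha}$. A square has weight $1$, a circle has weight $\log_n m$, and $w(X)$ is the sum of the weights of the elements of a vertex set $X$. $I_s(\alpha)$ is the set of vertices outside $U_\alpha\cup V_\alpha$ that lie on no edge; $\alpha$ is *proper* if $I_s(\alpha)=\emptyset$, and *trivial* if $V(\alpha)=U_\alpha=V_\alpha$ and it has no edges. The transpose $\alpha^\top$ exchanges $U_\alpha$ and $V_\alpha$. *Separators.* A set of vertices separates $A$ from $B$ if it meets every path from $A$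 to $B$ (including paths of length $0$). A *square separator* consists of squares only; it is *minimum* if its cardinality is minimum. A *separator of $\alpha$* separates $U_\alpha$ from $V_\alpha$. Let $S_\alpha$ be a separator of $\alpha$ of minimum weight, and $$A_{\mathrm{norm}}(\alpha)=n^{\frac{w(V(\alpha))+w(I_s(\alpha))-w(S_\alpha)}{2}} .$$ $\alpha$ is a *left shape* if $V_\alpha$ is the unique minimum square separator of $\alpha$ and every vertex outside $V_\alpha$ is reachable from $U_\alpha$ by a path avoiding $V_\alpha$; a *right shape* if $\alpha^\top$ is a left shape; a *middle shape* if $U_\alpha$ and $V_\alpha$ are both minimum square separators of $\alpha$. A *simple spider* is a trivial shape, or a shape with exactly one circle, all of whose squares lie in $U_\alpha\cup V_\alpha$, and whose edges are one label-$1$ edge from the circle to each square lying in exactly one of $U_\alpha,V_\alpha$. An *SSD* is a disjoint union of simple spiders (the indices being the unions of the indices). *Configurations.* An *intersection configuration* $\mathcal P$ of length $j\ge1$ is a sequence of proper shapes $\gamma_j,\dots,\gamma_1,\tau,\gamma_1'^\top,\dots,\gamma_j'^\top$ and an equivalence relation $\equiv$ on the union $V(\mathcal P)$ of their vertex sets such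 that: 1. in each shape, every square has total degree at least $2$ and every circle has degree at least $k$; 2. $\tau$ is a middle shape, each $\gamma_i$ is a left shape, each $\gamma_i'^\top$ is a right shape, and for each $i$ at least one of $\gamma_i,\gamma_i'^\top$ is non-trivial; 3. the right index of each shape equals the left index of the next one, and there are no other coincidences of vertices between the shapes (a vertex of two shapes lies in all indices between them); 4. equivalent vertices are both squares or both circles, and no two distinct vertices of the same shape are equivalent; 5. for each $i$, $U_{\gamma_i}$ is a minimum square separator in $\gamma_i$ between $U_{\gamma_i}$ and $V_{\gamma_i}\cup \mathrm{Int}(\gamma_i)$, where $\mathrm{Int}(\gamma_i)$ is the set of vertices of $V(\gamma_i)\setminus V_{\gamma_i}$ equivalent to a vertex of one of $\gamma_{i-1},\dots,\gamma_1,\tau,\gamma_1'^\top,\dots,\gamma_i'^\top$; and $V_{\gamma_i'^\top}$ is a minimum square separator in $\gamma_i'^\top$ between $U_{\gamma_i'^\top}\cup\mathrm{Int}(\gamma_i'^\top)$ and $V_{\gamma_i'^\top}$, where $\mathrm{Int}(\gamma_i'^\top)$ is the set of vertices of $V(\gamma_i'^\top)\setminus U_{\gamma_i'^\top}$ equivalent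 to a vertex of one of $\gamma_i,\dots,\gamma_1,\tau,\gamma_1'^\top,\dots,\gamma_{i-1}'^\top$. Let $E(\mathcal P)$ be the disjoint union of the edge sets, $\mathrm{total}(\mathcal P)=|V(\mathcal P)|+\sum_{e\in E(\mathcal P)}l(e)$, and let $\lambda_{\mathcal P}$ be the product of the $\lambda_\alpha$ over all shapes $\alpha$ of $\mathcal P$. The *result* $\tau_{\mathcal P}$ is the shape on the $\equiv$-classes whose left (right) index is the set of classes of $U_{\gamma_j}$ (of $V_{\gamma_j'^\top}$), in which all edges between two given classes, with labels $i_1,\dots,i_t$, are replaced by a single edge whose label is the least $i$ such that the Hermite polynomial $h_i$ appears in the Hermite expansion of $h_{i_1}\cdots h_{i_t}$ (label $0$ means no edge). Put $D_{\mathrm{side}}=\max\{|U_{\tau_{\mathcal P}}|,|V_{\tau_{\mathcal P}}|\}$. $\mathcal P$ is *well-behaved* if all its shapes are SSDs, no two distinct squares of $V(\mathcal P)$ are equivalent, and every square $v\in V(\mathcal P)$ whose class is not in $U_{\tau_{\mathcal P}}\cup V_{\tau_{\mathcal P}}$ has exactly two neighbours, which are equivalent, and the resulting double edge vanishes (has label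 $0$) in $\tau_{\mathcal P}$. **Theorem.** For every intersection configuration $\mathcal P$: 1. if $\mathcal P$ is well-behaved, then $\lambda_{\mathcal P}\,A_{\mathrm{norm}}(\tau_{\mathcal P})=1$; 2. if $\mathcal P$ is not well-behaved, then $$\lambda_{\mathcal P}\,A_{\mathrm{norm}}(\tau_{\mathcal P})\le n^{-\max\left\{\frac{\varepsilon}{8},\ \frac{\varepsilon}{12}\left(\mathrm{total}(\mathcal P)-12D_{\mathrm{side}}^2\right)\right\}} .$$ -/

import Mathlib

noncomputable section

namespace GraphMatrix

/-! ### Shapes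

A shape has square vertices (drawn from `Sq`) and circle vertices (drawn from `Ci`). Every edge joins
a square to a circle and carries a positive label; the label `0` means that there is no edge, so a
`Shape` has no multi-edges. The two indices `U = left` and `V = right` consist of squares. -/

structure Shape (Sq Ci : Type) where
  squares : Finset Sq
  circles : Finset Ci
  label : Sq → Ci → ℕ
  left : Finset Sq
  right : Finset Sq
  left_subset : left ⊆ squares
  right_subset : right ⊆ squares
  mem_of_label_ne_zero : ∀ s c, label s c ≠ 0 → s ∈ squares ∧ c ∈ circles

namespace Shape

variable {Sq Ci : Type}

/-- The vertex set `V(α)`. -/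
def vertices (α : Shape Sq Ci) : Finset (Sq ⊕ Ci) := α.squares.disjSum α.circles

/-- The left index `U_α` as a set of vertices. -/
def leftSet (α : Shape Sq Ci) : Set (Sq ⊕ Ci) := Sum.inl '' (α.left : Set Sq)

/-- The right index `V_α` as a set of vertices. -/
def rightSet (α : Shape Sq Ci) : Set (Sq ⊕ Ci) := Sum.inl '' (α.right : Set Sq)

/-- The underlying (bipartite, unlabelled) graph. -/
def graph (α : Shape Sq Ci) : SimpleGraph (Sq ⊕ Ci) :=
  SimpleGraph.fromRel fun x y => ∃ s c, x = Sum.inl s ∧ y = Sum.inr c ∧ α.label s c ≠ 0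

/-- The weight `w(E(α))`: the sum of all edge labels. -/
def edgeWeight (α : Shape Sq Ci) : ℕ := ∑ s ∈ α.squares, ∑ c ∈ α.circles, α.label s c

/-- The total size `|V(α)| + w(E(α))`. -/
def totalSize (α : Shape Sq Ci) : ℕ := α.vertices.card + α.edgeWeight

/-- The degree of a square: the sum of the labels of the incident edges. -/
def squareDegree (α : Shape Sq Ci) (s : Sq) : ℕ := ∑ c ∈ α.circles, α.label s c

/-- The degree of a circle: the sum of the labels of the incident edges. -/
def circleDegree (α : Shape Sq Ci) (c : Ci) : ℕ := ∑ s ∈ α.squares, α.label s c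

open Classical in
/-- The total degree of a square: `deg(s) + 1_{s ∈ U} + 1_{s ∈ V}`. -/
def squareTotalDegree (α : Shape Sq Ci) (s : Sq) : ℕ :=
  α.squareDegree s + (if s ∈ α.left then 1 else 0) + (if s ∈ α.right then 1 else 0)

/-- The scaling coefficient `λ_α = n ^ (-w(E(α)) / 2)`. -/
def scalingCoeff (n : ℕ) (α : Shape Sq Ci) : ℝ := (n : ℝ) ^ (-(α.edgeWeight : ℝ) / 2)

open Classical in
/-- `I_s(α)`: the isolated middle vertices, i.e. the vertices outside `U ∪ V` without edges. -/
def isolated (α : Shape Sq Ci) : Finset (Sq ⊕ Ci) :=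
  α.vertices.filter fun x => x ∉ α.leftSet ∧ x ∉ α.rightSet ∧ ∀ y, ¬ α.graph.Adj x y

/-- A shape is proper if it has no isolated middle vertices (and no multi-edges, which a `Shape`
never has). -/
def IsProper (α : Shape Sq Ci) : Prop := α.isolated = ∅

/-- A shape is trivial if `V(α) = U_α = V_α` and there are no edges. -/
def IsTrivial (α : Shape Sq Ci) : Prop :=
  α.circles = ∅ ∧ α.left = α.squares ∧ α.right = α.squares ∧ ∀ s c, α.label s c = 0

def transpose (α : Shape Sq Ci) : Shape Sq Ci where
  squares := α.squares
  circles := α.circles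
  label := α.label
  left := α.right
  right := α.left
  left_subset := α.right_subset
  right_subset := α.left_subset
  mem_of_label_ne_zero := α.mem_of_label_ne_zero

/-! ### Separators -/

/-- Every path from `A` to `B` (paths of length `0` included) contains a vertex of `S`. -/
def Separates (α : Shape Sq Ci) (A B S : Set (Sq ⊕ Ci)) : Prop :=
  ∀ a ∈ A, ∀ b ∈ B, ∀ p : α.graph.Walk a b, p.IsPath → ∃ x ∈ p.support, x ∈ S

/-- `S ⊆ V(α)` is a vertex separator of `α`. -/
def IsVertexSeparator (α : Shape Sq Ci) (S : Finset (Sq ⊕ Ci)) : Prop :=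
  S ⊆ α.vertices ∧ α.Separates α.leftSet α.rightSet S

/-- The set `S` of squares of `α` is a square separator between `A` and `B`. -/
def IsSquareSeparator (α : Shape Sq Ci) (A B : Set (Sq ⊕ Ci)) (S : Finset Sq) : Prop :=
  S ⊆ α.squares ∧ α.Separates A B (Sum.inl '' (S : Set Sq))

/-- `S` is a square separator between `A` and `B` of minimum size. -/
def IsMinSquareSeparator (α : Shape Sq Ci) (A B : Set (Sq ⊕ Ci)) (S : Finset Sq) : Prop :=
  α.IsSquareSeparator A B S ∧ ∀ T, α.IsSquareSeparator A B T → S.card ≤ T.card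

/-- The weight of a vertex: `1` for a square, `log_n m` for a circle. -/
def vertexWeight (n m : ℕ) : Sq ⊕ Ci → ℝ
  | Sum.inl _ => 1
  | Sum.inr _ => Real.logb n m

/-- The weight of a set of vertices. -/
def weight (n m : ℕ) (S : Finset (Sq ⊕ Ci)) : ℝ := ∑ x ∈ S, vertexWeight n m x

/-- `S` is a vertex separator of `α` of minimum weight. -/
def IsMinWeightSeparator (n m : ℕ) (α : Shape Sq Ci) (S : Finset (Sq ⊕ Ci)) : Prop :=
  α.IsVertexSeparator S ∧ ∀ T, α.IsVertexSeparator T → weight n m S ≤ weight n m T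

theorem exists_isMinWeightSeparator (n m : ℕ) (α : Shape Sq Ci) :
    ∃ S, IsMinWeightSeparator n m α S := by
  classical
  have hV : α.vertices ∈ α.vertices.powerset.filter fun S => α.IsVertexSeparator S := by
    refine Finset.mem_filter.2 ⟨Finset.mem_powerset_self _, Finset.Subset.refl _, ?_⟩
    rintro a ⟨s, hs, rfl⟩ b _ p _
    exact ⟨Sum.inl s, p.start_mem_support,
      by simpa [vertices] using α.left_subset hs⟩
  obtain ⟨S, hS, hmin⟩ := Finset.exists_min_image _ (fun S => weight n m S) ⟨_, hV⟩
  refine ⟨S, (Finset.mem_filter.1 hS).2, fun T hT => hmin T ?_⟩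
  exact Finset.mem_filter.2 ⟨Finset.mem_powerset.2 hT.1, hT⟩

/-- A minimum weight separator `S_α` of `α`. -/
def minWeightSeparator (n m : ℕ) (α : Shape Sq Ci) : Finset (Sq ⊕ Ci) :=
  (exists_isMinWeightSeparator n m α).choose

/-- The approximate norm bound `A_norm(α) = n ^ ((w(V(α)) + w(I_s(α)) - w(S_α)) / 2)`. -/
def approxNorm (n m : ℕ) (α : Shape Sq Ci) : ℝ :=
  (n : ℝ) ^ ((weight n m α.vertices + weight n m α.isolated
    - weight n m (minWeightSeparator n m α)) / 2)

/-! ### Left, right and middle shapes -/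

/-- `V_σ` is the unique minimum square separator of `σ`, and every vertex outside `V_σ` is reachable
from `U_σ` by a path that avoids `V_σ`. -/
def IsLeft (σ : Shape Sq Ci) : Prop :=
  σ.IsMinSquareSeparator σ.leftSet σ.rightSet σ.right ∧
  (∀ S, σ.IsMinSquareSeparator σ.leftSet σ.rightSet S → S = σ.right) ∧
  ∀ x ∈ σ.vertices, x ∉ σ.rightSet →
    ∃ a ∈ σ.leftSet, ∃ p : σ.graph.Walk a x, p.IsPath ∧ ∀ y ∈ p.support, y ∉ σ.rightSet

def IsRight (σ : Shape Sq Ci) : Prop := σ.transpose.IsLeft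

/-- `U_τ` and `V_τ` are minimum square separators of `τ`. -/
def IsMiddle (τ : Shape Sq Ci) : Prop :=
  τ.IsMinSquareSeparator τ.leftSet τ.rightSet τ.left ∧
  τ.IsMinSquareSeparator τ.leftSet τ.rightSet τ.right

/-! ### Simple spiders and their disjoint unions -/

/-- A simple spider: a trivial shape, or a shape with exactly one circle, all of whose squares lie in
`U ∪ V`, with a label-1 edge from the circle to each square in exactly one of `U`, `V`, and with no
other edges. -/
def IsSimpleSpider (α : Shape Sq Ci) : Prop :=
  α.IsTrivial ∨
  ∃ c, α.circles = {c} ∧ (∀ s ∈ α.squares, s ∈ α.left ∨ s ∈ α.right) ∧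
    ∀ s ∈ α.squares, (¬ (s ∈ α.left ∧ s ∈ α.right) → α.label s c = 1) ∧
      (s ∈ α.left ∧ s ∈ α.right → α.label s c = 0)

/-- A disjoint union of (finitely many) simple spiders. -/
def IsSSD (α : Shape Sq Ci) : Prop :=
  ∃ (r : ℕ) (β : Fin r → Shape Sq Ci),
    (∀ t, (β t).IsSimpleSpider) ∧
    (∀ t t', t ≠ t' → Disjoint (β t).vertices (β t').vertices) ∧
    (∀ x, x ∈ α.vertices ↔ ∃ t, x ∈ (β t).vertices) ∧
    (∀ s, s ∈ α.left ↔ ∃ t, s ∈ (β t).left) ∧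
    (∀ s, s ∈ α.right ↔ ∃ t, s ∈ (β t).right) ∧
    ∀ s c, α.label s c = ∑ t, (β t).label s c

end Shape

/-! ### Linearization of multi-edges -/

/-- The Hermite polynomial `h_i` (probabilists' normalization) occurs with a nonzero coefficient in
the expansion of `p` as a linear combination of Hermite polynomials. -/
def HermiteAppears (i : ℕ) (p : Polynomial ℤ) : Prop :=
  ∃ a : ℕ →₀ ℤ, p = a.sum (fun l r => Polynomial.C r * Polynomial.hermite l) ∧ a i ≠ 0

/-- The smallest `i` such that `h_i` appears in the Hermite expansion of `p`. -/
def minHermiteIndex (p : Polynomial ℤ) : ℕ := sInf {i | HermiteAppears i p}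

theorem minHermiteIndex_one : minHermiteIndex 1 = 0 := by
  refine Nat.sInf_eq_zero.2 (Or.inl ⟨Finsupp.single 0 1, ?_, by simp⟩)
  rw [Finsupp.sum_single_index] <;> simp

/-! ### Intersection configurations -/

/-- An intersection configuration of length `j`. The shapes `γ_j, …, γ_1, τ, γ'_1ᵀ, …, γ'_jᵀ` are
`shape (-j), …, shape (-1), shape 0, shape 1, …, shape j` (other values of `shape` play no role), and
their vertices are taken from a fixed supply `ℕ ⊕ ℕ` of squares and circles. The relation `≡` is
`equiv`; only its restriction to the vertices of the configuration plays a role. -/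
structure IntersectionConfiguration (k : ℕ) where
  j : ℕ
  shape : ℤ → Shape ℕ ℕ
  equiv : Setoid (ℕ ⊕ ℕ)
  one_le_length : 1 ≤ j
  two_le_totalDegree : ∀ i ∈ Finset.Icc (-(j : ℤ)) j, ∀ s ∈ (shape i).squares,
    2 ≤ (shape i).squareTotalDegree s
  le_circleDegree : ∀ i ∈ Finset.Icc (-(j : ℤ)) j, ∀ c ∈ (shape i).circles,
    k ≤ (shape i).circleDegree c
  isProper : ∀ i ∈ Finset.Icc (-(j : ℤ)) j, (shape i).IsProper
  isMiddle : (shape 0).IsMiddle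
  isLeft : ∀ i ∈ Finset.Icc (-(j : ℤ)) (-1), (shape i).IsLeft
  isRight : ∀ i ∈ Finset.Icc (1 : ℤ) j, (shape i).IsRight
  not_both_trivial : ∀ i ∈ Finset.Icc (1 : ℤ) j, ¬ ((shape (-i)).IsTrivial ∧ (shape i).IsTrivial)
  composable : ∀ i ∈ Finset.Ico (-(j : ℤ)) j, (shape i).right = (shape (i + 1)).left
  /-- There are no other coincidences between the vertices of the shapes: a vertex that lies in two
  shapes lies in all the indices between them. -/
  no_other_identification : ∀ a ∈ Finset.Icc (-(j : ℤ)) j, ∀ b ∈ Finset.Icc (-(j : ℤ)) j, a < b →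
    ∀ x ∈ (shape a).vertices, x ∈ (shape b).vertices → ∀ i ∈ Finset.Ioc a b, x ∈ (shape i).leftSet
  /-- Equivalent vertices are of the same sort. -/
  same_sort : ∀ x y, equiv x y → (x.isLeft = true ↔ y.isLeft = true)
  /-- The restriction of `≡` to each shape is trivial. -/
  trivial_on_shapes : ∀ i ∈ Finset.Icc (-(j : ℤ)) j, ∀ x ∈ (shape i).vertices,
    ∀ y ∈ (shape i).vertices, equiv x y → x = y
  /-- Intersection-separation for `γ_i`, which is `shape (-i)`: its left index is a minimum square
  separator between itself and the union of the right index with the vertices (outside the right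
  index) that are equivalent to a vertex of one of `γ_{i-1}, …, γ_1, τ, γ'_1ᵀ, …, γ'_iᵀ`. -/
  separation_left : ∀ i ∈ Finset.Icc (1 : ℤ) j,
    (shape (-i)).IsMinSquareSeparator (shape (-i)).leftSet
      ({x | x ∈ (shape (-i)).vertices ∧ x ∉ (shape (-i)).rightSet ∧
        ∃ i' ∈ Finset.Ioc (-i) i, ∃ y ∈ (shape i').vertices, equiv x y} ∪ (shape (-i)).rightSet)
      (shape (-i)).left
  /-- Intersection-separation for `γ'_iᵀ`, which is `shape i`. -/
  separation_right : ∀ i ∈ Finset.Icc (1 : ℤ) j,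
    (shape i).IsMinSquareSeparator
      ((shape i).leftSet ∪ {x | x ∈ (shape i).vertices ∧ x ∉ (shape i).leftSet ∧
        ∃ i' ∈ Finset.Ico (-i) i, ∃ y ∈ (shape i').vertices, equiv x y})
      (shape i).rightSet (shape i).right

namespace IntersectionConfiguration

variable {k : ℕ}

/-- The indices `-j, …, j` of the shapes. -/
def indices (P : IntersectionConfiguration k) : Finset ℤ := Finset.Icc (-(P.j : ℤ)) P.j

/-- The square vertices of `V(P)`; matched index vertices are counted once. -/
def squares (P : IntersectionConfiguration k) : Finset ℕ :=
  P.indices.biUnion fun i => (P.shape i).squares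

/-- The circle vertices of `V(P)`. -/
def circles (P : IntersectionConfiguration k) : Finset ℕ :=
  P.indices.biUnion fun i => (P.shape i).circles

/-- `total(P) = |V(P)| + w(E(P))`, where `E(P)` is the disjoint union of the edge sets. -/
def totalSize (P : IntersectionConfiguration k) : ℕ :=
  P.squares.card + P.circles.card + ∑ i ∈ P.indices, (P.shape i).edgeWeight

/-- `λ_P`, the product of the scaling coefficients of the shapes in `P`. -/
def scalingCoeff (n : ℕ) (P : IntersectionConfiguration k) : ℝ :=
  ∏ i ∈ P.indices, (P.shape i).scalingCoeff n

/-- Classes of squares. -/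
abbrev SquareClass (P : IntersectionConfiguration k) : Type := Quotient (P.equiv.comap Sum.inl)

/-- Classes of circles. -/
abbrev CircleClass (P : IntersectionConfiguration k) : Type := Quotient (P.equiv.comap Sum.inr)

/-- The class `[s]` of a square. -/
def squareClass (P : IntersectionConfiguration k) (s : ℕ) : P.SquareClass := Quotient.mk _ s

/-- The class `[c]` of a circle. -/
def circleClass (P : IntersectionConfiguration k) (c : ℕ) : P.CircleClass := Quotient.mk _ c

open Classical in
/-- The product of `h_{l(e)}` over all edges `e` of `E(P)` between two classes (pairs without an edge
have label `0` and contribute the factor `h_0 = 1`). -/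
def hermiteProduct (P : IntersectionConfiguration k) (q : P.SquareClass) (r : P.CircleClass) :
    Polynomial ℤ :=
  ∏ i ∈ P.indices, ∏ s ∈ (P.shape i).squares.filter (fun s => P.squareClass s = q),
    ∏ c ∈ (P.shape i).circles.filter (fun c => P.circleClass c = r),
      Polynomial.hermite ((P.shape i).label s c)

open Classical in
/-- The result `τ_P`: the quotient of the union of the shapes by `≡`, where the edges between two
classes are replaced by one edge with the smallest label in the linearization. -/
def result (P : IntersectionConfiguration k) : Shape P.SquareClass P.CircleClass where
  squares := P.squares.image P.squareClass
  circles := P.circles.image P.circleClass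
  label q r := minHermiteIndex (P.hermiteProduct q r)
  left := (P.shape (-(P.j : ℤ))).left.image P.squareClass
  right := (P.shape (P.j : ℤ)).right.image P.squareClass
  left_subset := by
    refine Finset.image_subset_image fun s hs => Finset.mem_biUnion.2 ⟨-(P.j : ℤ), ?_, ?_⟩
    · exact Finset.mem_Icc.2 ⟨le_rfl, by omega⟩
    · exact (P.shape _).left_subset hs
  right_subset := by
    refine Finset.image_subset_image fun s hs => Finset.mem_biUnion.2 ⟨(P.j : ℤ), ?_, ?_⟩
    · exact Finset.mem_Icc.2 ⟨by omega, le_rfl⟩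
    · exact (P.shape _).right_subset hs
  mem_of_label_ne_zero q r h := by
    by_contra hcon
    apply h
    have h1 : P.hermiteProduct q r = 1 := by
      refine Finset.prod_eq_one fun i hi => Finset.prod_eq_one fun s hs =>
        Finset.prod_eq_one fun c hc => ?_
      rw [Finset.mem_filter] at hs hc
      exact absurd ⟨Finset.mem_image.2 ⟨s, Finset.mem_biUnion.2 ⟨i, hi, hs.1⟩, hs.2⟩,
        Finset.mem_image.2 ⟨c, Finset.mem_biUnion.2 ⟨i, hi, hc.1⟩, hc.2⟩⟩ hcon
    rw [h1, minHermiteIndex_one]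

/-- `D_side = max {|U_{τ_P}|, |V_{τ_P}|}`. -/
def sideSize (P : IntersectionConfiguration k) : ℕ :=
  max P.result.left.card P.result.right.card

/-- The neighbours of a square in the shapes of `P`. -/
def neighbors (P : IntersectionConfiguration k) (s : ℕ) : Set ℕ :=
  {c | ∃ i ∈ P.indices, (P.shape i).label s c ≠ 0}

/-- Well-behaved configurations: all shapes are disjoint unions of simple spiders; there are no
non-trivial intersections between squares; and each square whose class lies outside the indices of
`τ_P` has exactly two neighbours, these two intersect, and the resulting double edge vanishes. -/
def IsWellBehaved (P : IntersectionConfiguration k) : Prop :=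
  (∀ i ∈ P.indices, (P.shape i).IsSSD) ∧
  (∀ s ∈ P.squares, ∀ s' ∈ P.squares, P.equiv (Sum.inl s) (Sum.inl s') → s = s') ∧
  ∀ s ∈ P.squares, P.squareClass s ∉ P.result.left → P.squareClass s ∉ P.result.right →
    ∃ u u', u ≠ u' ∧ P.neighbors s = {u, u'} ∧ P.equiv (Sum.inr u) (Sum.inr u') ∧
      P.result.label (P.squareClass s) (P.circleClass u) = 0

end IntersectionConfiguration

end GraphMatrix

end

open Finset

namespace GraphMatrix

/-! ### Hermite expansions -/

/-! Let `S` be a minimum weight separator of the result, `E` the total label weight of the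
configuration and `ω = log_n m`. The quantity to estimate is the exponent `(w(V) + w(I_s) - w(S) -
E) / 2`, where `V` and `I_s` belong to the result. The estimate splits into one local inequality for
each shape.

The classes reachable from the left index without meeting `S` form the left side and the remaining
classes outside `S` the right side. Isolated classes, which the norm bound counts twice, belong to
both. A left-side class is charged to its rightmost representatives in the chain of shapes and a
right-side class to its leftmost ones, which gives two colours in every shape. An edge between the
two colours would be the only edge between its two classes. It would then keep its label in the
result (`result_adj_of_unique`) and contradict separation or isolation, so no such edge exists
(`not_adj_leftColor_rightColor`). The same argument shows that no vertex has both colours.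

Hence the boundary of each colour is a square separator of the shape. Being rightmost (leftmost) is
exactly what keeps coloured vertices out of the sets `Int` of the intersection-separation condition,
so these separators are at least as large as the left (right) index. Degree counting then yields `2
* (coloured squares) + k * (coloured circles) ≤ 2 * edgeWeight` for each shape
(`color_add_circles_le`). Let `slack` be the sum over the shapes of `2 * edgeWeight - 2 * (coloured
squares)`. Since `2ω ≤ (1 - ε)k`, the circles use up at most a `1 - ε` share of it, and the exponent
is at most `-ε * slack / 4` (`weight_add_slack_le`).

Two facts about the slack finish the second claim. If it vanishes, every local count is tight and
the configuration is well-behaved (`isWellBehaved_of_tight`). It also controls the size: a second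
count bounds squares outside the indices and excess degrees by the slack, while the index sizes grow
strictly outwards and so sum to `O(D_side²)` (`totalSize_le_slack`).

For the first claim the bound above gives `≤ 1`. The reverse inequality comes from comparing `S`
with the explicit separator made of all circles and the squares in both indices
(`IsWellBehaved.edgeWeight_add_weight_le`). -/

theorem linearIndependent_hermite : LinearIndependent ℤ Polynomial.hermite :=
  Polynomial.Sequence.linearIndependent ⟨Polynomial.hermite, Polynomial.degree_hermite⟩

theorem hermiteAppears_hermite_iff {i l : ℕ} :
    HermiteAppears i (Polynomial.hermite l) ↔ i = l := by
  constructor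
  · rintro ⟨a, ha, hi⟩
    have h1 : Finsupp.linearCombination ℤ Polynomial.hermite a =
        Finsupp.linearCombination ℤ Polynomial.hermite (Finsupp.single l 1) := by
      rw [Finsupp.linearCombination_single, one_smul, ha, Finsupp.linearCombination_apply]
      simp only [Polynomial.smul_eq_C_mul]
    have h2 := linearIndependent_hermite h1
    rw [h2, Finsupp.single_apply] at hi
    by_contra hne
    exact hi (if_neg fun h => hne h.symm)
  · rintro rfl
    refine ⟨Finsupp.single i 1, ?_, by simp⟩
    rw [Finsupp.sum_single_index] <;> simp

/-- Together with `minHermiteIndex_one`, this is all that is needed about linearization: an edge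
that is alone between its two classes keeps its label. -/
theorem minHermiteIndex_hermite (l : ℕ) : minHermiteIndex (Polynomial.hermite l) = l := by
  have : {i | HermiteAppears i (Polynomial.hermite l)} = {l} :=
    Set.ext fun i => hermiteAppears_hermite_iff
  rw [minHermiteIndex, this, csInf_singleton]

namespace Shape

variable {Sq Ci : Type}

/-! ### Adjacency, separators and weights -/

@[simp] theorem graph_adj_inl_inr {α : Shape Sq Ci} {s : Sq} {c : Ci} :
    α.graph.Adj (Sum.inl s) (Sum.inr c) ↔ α.label s c ≠ 0 := by
  simp [graph]

@[simp] theorem graph_adj_inr_inl {α : Shape Sq Ci} {s : Sq} {c : Ci} :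
    α.graph.Adj (Sum.inr c) (Sum.inl s) ↔ α.label s c ≠ 0 := by
  rw [SimpleGraph.adj_comm, graph_adj_inl_inr]

@[simp] theorem not_graph_adj_inl_inl {α : Shape Sq Ci} {s t : Sq} :
    ¬ α.graph.Adj (Sum.inl s) (Sum.inl t) := by
  simp [graph]

@[simp] theorem not_graph_adj_inr_inr {α : Shape Sq Ci} {c d : Ci} :
    ¬ α.graph.Adj (Sum.inr c) (Sum.inr d) := by
  simp [graph]

@[simp] theorem inl_mem_vertices {α : Shape Sq Ci} {s : Sq} :
    Sum.inl s ∈ α.vertices ↔ s ∈ α.squares := by simp [vertices]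

@[simp] theorem inr_mem_vertices {α : Shape Sq Ci} {c : Ci} :
    Sum.inr c ∈ α.vertices ↔ c ∈ α.circles := by simp [vertices]

@[simp] theorem inl_mem_leftSet {α : Shape Sq Ci} {s : Sq} :
    Sum.inl s ∈ α.leftSet ↔ s ∈ α.left := by simp [leftSet]

@[simp] theorem inr_notMem_leftSet {α : Shape Sq Ci} {c : Ci} :
    (Sum.inr c : Sq ⊕ Ci) ∉ α.leftSet := by simp [leftSet]

@[simp] theorem inl_mem_rightSet {α : Shape Sq Ci} {s : Sq} :
    Sum.inl s ∈ α.rightSet ↔ s ∈ α.right := by simp [rightSet]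

@[simp] theorem inr_notMem_rightSet {α : Shape Sq Ci} {c : Ci} :
    (Sum.inr c : Sq ⊕ Ci) ∉ α.rightSet := by simp [rightSet]

theorem mem_vertices_of_adj {α : Shape Sq Ci} {x y : Sq ⊕ Ci} (h : α.graph.Adj x y) :
    x ∈ α.vertices := by
  rcases x with s | c <;> rcases y with t | d
  · simp at h
  · simpa using (α.mem_of_label_ne_zero s d (by simpa using h)).1
  · simpa using (α.mem_of_label_ne_zero t c (by simpa using h)).2
  · simp at h

theorem Separates.symm {α : Shape Sq Ci} {A B S : Set (Sq ⊕ Ci)} (h : α.Separates A B S) :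
    α.Separates B A S := by
  intro b hb a ha p hp
  obtain ⟨x, hx, hxS⟩ := h a ha b hb p.reverse hp.reverse
  exact ⟨x, by simpa using hx, hxS⟩

/-- If the region `G` can only be left through `S`, then `S` separates `A` from `B`. -/
theorem separates_of_region {α : Shape Sq Ci} {A B S G : Set (Sq ⊕ Ci)} (hA : A ⊆ G ∪ S)
    (hstep : ∀ x ∈ G, ∀ y, α.graph.Adj x y → y ∈ G ∪ S) (hB : ∀ b ∈ B, b ∉ G) :
    α.Separates A B S := by
  have key : ∀ a b, ∀ p : α.graph.Walk a b, a ∈ G ∪ S → b ∉ G → ∃ x ∈ p.support, x ∈ S := by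
    intro a b p
    induction p with
    | nil => exact fun ha hb => ⟨_, by simp, ha.resolve_left hb⟩
    | cons h p ih =>
      rintro (ha | ha) hb
      · obtain ⟨x, hx, hxS⟩ := ih (hstep _ ha _ h) hb
        exact ⟨x, by simp [hx], hxS⟩
      · exact ⟨_, by simp, ha⟩
  exact fun a ha b hb p _ => key a b p (hA ha) (hB b hb)

theorem Separates.exists_mem_of_walk {α : Shape Sq Ci} {A B S : Set (Sq ⊕ Ci)}
    (h : α.Separates A B S) {a b : Sq ⊕ Ci} (ha : a ∈ A) (hb : b ∈ B) (p : α.graph.Walk a b) :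
    ∃ x ∈ p.support, x ∈ S := by
  classical
  obtain ⟨x, hx, hxS⟩ := h a ha b hb p.bypass p.bypass_isPath
  exact ⟨x, p.support_bypass_subset_support hx, hxS⟩

theorem sum_circleDegree (α : Shape Sq Ci) : ∑ c ∈ α.circles, α.circleDegree c = α.edgeWeight :=
  Finset.sum_comm

theorem sum_squareDegree (α : Shape Sq Ci) : ∑ s ∈ α.squares, α.squareDegree s = α.edgeWeight :=
  rfl

theorem squareDegree_eq_zero_iff {α : Shape Sq Ci} {s : Sq} :
    α.squareDegree s = 0 ↔ ∀ c, α.label s c = 0 := by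
  rw [squareDegree, Finset.sum_eq_zero_iff]
  refine ⟨fun h c => ?_, fun h c _ => h c⟩
  by_contra hc
  exact hc (h c (α.mem_of_label_ne_zero s c hc).2)

theorem exists_label_ne_zero_of_notMem {α : Shape Sq Ci} {s : Sq}
    (hdeg : 2 ≤ α.squareTotalDegree s) (h : ¬ (s ∈ α.left ∧ s ∈ α.right)) :
    ∃ c, α.label s c ≠ 0 := by
  classical
  by_contra! hcon
  have h0 := squareDegree_eq_zero_iff.2 hcon
  rw [squareTotalDegree, h0] at hdeg
  by_cases h1 : s ∈ α.left <;> by_cases h2 : s ∈ α.right <;> simp_all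

theorem exists_label_ne_zero_of_circleDegree {α : Shape Sq Ci} {c : Ci}
    (hdeg : 0 < α.circleDegree c) : ∃ s, α.label s c ≠ 0 := by
  by_contra! hcon
  simp [circleDegree, hcon] at hdeg

open Classical in
theorem sum_squareTotalDegree (α : Shape Sq Ci) :
    ∑ s ∈ α.squares, α.squareTotalDegree s = α.edgeWeight + α.left.card + α.right.card := by
  simp only [squareTotalDegree, sum_add_distrib, sum_squareDegree]
  congr 2
  · rw [Finset.sum_ite_mem, inter_eq_right.2 α.left_subset]; simp
  · rw [Finset.sum_ite_mem, inter_eq_right.2 α.right_subset]; simp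

theorem weight_mono {n m : ℕ} {S T : Finset (Sq ⊕ Ci)} (hω : 0 ≤ Real.logb n m) (h : S ⊆ T) :
    weight n m S ≤ weight n m T :=
  Finset.sum_le_sum_of_subset_of_nonneg h fun x _ _ => by
    rcases x with s | c <;> simp [vertexWeight, hω]

theorem weight_eq (n m : ℕ) (S : Finset (Sq ⊕ Ci)) :
    weight n m S = S.toLeft.card + Real.logb n m * S.toRight.card := by
  rw [weight, ← toLeft_disjSum_toRight (u := S), sum_disjSum]
  simp [vertexWeight, mul_comm]

/-- A left shape with indices of equal size is trivial. -/
theorem IsLeft.isTrivial {α : Shape Sq Ci} (h : α.IsLeft) (hc : α.left.card ≤ α.right.card) :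
    α.IsTrivial := by
  obtain ⟨hmin, huniq, hreach⟩ := h
  have hl : α.left = α.right := by
    refine huniq _ ⟨⟨α.left_subset, ?_⟩, fun T hT => hc.trans (hmin.2 T hT)⟩
    exact fun a ha b _ p _ => ⟨a, p.start_mem_support, ha⟩
  -- The indices coincide, so every path from the left index starts in the right index, and nothing
  -- outside it can be reached while avoiding it.
  have hall : ∀ x ∈ α.vertices, x ∈ α.rightSet := by
    intro x hx
    by_contra hxr
    obtain ⟨a, ha, p, -, hp⟩ := hreach x hx hxr
    refine hp a p.start_mem_support ?_
    rwa [rightSet, ← hl]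
  have hcirc : α.circles = ∅ := by
    refine Finset.eq_empty_of_forall_notMem fun c hc => ?_
    exact inr_notMem_rightSet (hall (Sum.inr c) (inr_mem_vertices.2 hc))
  have hr : α.right = α.squares := by
    refine α.right_subset.antisymm fun s hs => ?_
    exact inl_mem_rightSet.1 (hall (Sum.inl s) (inl_mem_vertices.2 hs))
  refine ⟨hcirc, hl.trans hr, hr, fun s c => ?_⟩
  by_contra h0
  have := (α.mem_of_label_ne_zero s c h0).2
  simp [hcirc] at this

theorem IsLeft.card_right_le {α : Shape Sq Ci} (h : α.IsLeft) : α.right.card ≤ α.left.card :=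
  h.1.2 _ ⟨α.left_subset, fun a ha _ _ p _ => ⟨a, p.start_mem_support, ha⟩⟩

theorem IsTrivial.of_transpose {α : Shape Sq Ci} (h : α.transpose.IsTrivial) : α.IsTrivial :=
  ⟨h.1, h.2.2.1, h.2.1, h.2.2.2⟩

/-! ### Two-sided colourings of a shape -/

open Classical in
/-- The squares outside `A ∪ A'`, and the squares of `A` with a neighbour outside `C ∪ C'`. -/
noncomputable def frontier (α : Shape Sq Ci) (A A' : Finset Sq) (C C' : Finset Ci) : Finset Sq :=
  α.squares \ (A ∪ A') ∪ A.filter fun s => ∃ c, c ∉ C ∧ c ∉ C' ∧ α.label s c ≠ 0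

/-- The region of squares of `A` off the frontier and circles of `C` can only be left through the
frontier: no edge reaches the other colour, and a square of `A` touching an uncoloured circle is
itself in the frontier. -/
theorem isSquareSeparator_frontier {α : Shape Sq Ci} {A A' : Finset Sq} {C C' : Finset Ci}
    {X Y : Set (Sq ⊕ Ci)} (hA : A ⊆ α.squares)
    (hAC : ∀ s ∈ A, ∀ c ∈ C', α.label s c = 0) (hCA : ∀ s ∈ A', ∀ c ∈ C, α.label s c = 0)
    (hX : ∀ x ∈ X, ∃ s ∈ α.squares, s ∉ A' ∧ x = Sum.inl s)
    (hYA : ∀ s ∈ A, Sum.inl s ∉ Y) (hYC : ∀ c ∈ C, Sum.inr c ∉ Y) :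
    α.IsSquareSeparator X Y (α.frontier A A' C C') := by
  classical
  have hmem : ∀ s, s ∈ α.frontier A A' C C' ↔ (s ∈ α.squares ∧ s ∉ A ∧ s ∉ A') ∨
      (s ∈ A ∧ ∃ c, c ∉ C ∧ c ∉ C' ∧ α.label s c ≠ 0) := by
    intro s; simp [frontier]
  refine ⟨fun s hs => ?_, ?_⟩
  · rcases (hmem s).1 hs with h | h
    exacts [h.1, hA h.1]
  refine separates_of_region (G := {x | (∃ s ∈ A, s ∉ α.frontier A A' C C' ∧ x = Sum.inl s) ∨
    ∃ c ∈ C, x = Sum.inr c}) ?_ ?_ ?_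
  · intro x hx
    obtain ⟨s, hs, hsA, rfl⟩ := hX x hx
    by_cases hsT : s ∈ α.frontier A A' C C'
    · exact Or.inr ⟨s, hsT, rfl⟩
    · refine Or.inl (Or.inl ⟨s, ?_, hsT, rfl⟩)
      by_contra h
      exact hsT ((hmem s).2 (Or.inl ⟨hs, h, hsA⟩))
  · rintro x (⟨s, hs, hsT, rfl⟩ | ⟨c, hc, rfl⟩) (t | d) hadj
    · simp at hadj
    · have hl : α.label s d ≠ 0 := by simpa using hadj
      have hd : d ∉ C' := fun h => hl (hAC s hs d h)
      refine Or.inl (Or.inr ⟨d, ?_, rfl⟩)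
      by_contra h
      exact hsT ((hmem s).2 (Or.inr ⟨hs, d, h, hd, hl⟩))
    · have hl : α.label t c ≠ 0 := by simpa using hadj
      have ht : t ∉ A' := fun h => hl (hCA t h c hc)
      by_cases htT : t ∈ α.frontier A A' C C'
      · exact Or.inr ⟨t, htT, rfl⟩
      · refine Or.inl (Or.inl ⟨t, ?_, htT, rfl⟩)
        by_contra h
        exact htT ((hmem t).2 (Or.inl ⟨(α.mem_of_label_ne_zero t c hl).1, h, ht⟩))
    · simp at hadj
  · rintro y hy (⟨s, hs, -, rfl⟩ | ⟨c, hc, rfl⟩)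
    exacts [hYA s hs hy, hYC c hc hy]

/-- The main counting bound for a shape whose vertices are partly coloured by two colours, such that
there are no edges between differently coloured vertices. -/
theorem le_two_mul_edgeWeight {α : Shape Sq Ci} {A A' : Finset Sq} {C C' : Finset Ci}
    (hA : A ⊆ α.squares) (hA' : A' ⊆ α.squares) (hAA : Disjoint A A')
    (hC : C ⊆ α.circles) (hC' : C' ⊆ α.circles) (hCC : Disjoint C C')
    (hdeg : ∀ s ∈ α.squares, 2 ≤ α.squareTotalDegree s)
    (hleft : α.left.card ≤ (α.frontier A A' C C').card)
    (hright : α.right.card ≤ (α.frontier A' A C' C).card) :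
    2 * A.card + 2 * A'.card + ∑ c ∈ C, α.circleDegree c + ∑ c ∈ C', α.circleDegree c ≤
      2 * α.edgeWeight := by
  classical
  set D := α.circles \ (C ∪ C') with hD
  have hbound : ∀ A₀ ⊆ α.squares,
      (A₀.filter fun s => ∃ c, c ∉ C ∧ c ∉ C' ∧ α.label s c ≠ 0).card ≤
        ∑ s ∈ A₀, ∑ c ∈ D, α.label s c := by
    intro A₀ _
    rw [card_filter]
    refine sum_le_sum fun s _ => ?_
    split_ifs with h
    · obtain ⟨c, hc, hc', hl⟩ := h
      have hcD : c ∈ D := by simp [hD, hc, hc', (α.mem_of_label_ne_zero s c hl).2]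
      exact (Nat.one_le_iff_ne_zero.2 hl).trans
        (single_le_sum (f := fun c => α.label s c) (fun _ _ => Nat.zero_le _) hcD)
    · exact Nat.zero_le _
  have h1 := hbound A hA
  have h2 := hbound A' hA'
  have hsum : ∑ s ∈ A, ∑ c ∈ D, α.label s c + ∑ s ∈ A', ∑ c ∈ D, α.label s c ≤
      ∑ c ∈ D, α.circleDegree c := by
    rw [← sum_union hAA, sum_comm]
    exact sum_le_sum fun c _ => sum_le_sum_of_subset (union_subset hA hA')
  have hE : ∑ c ∈ D, α.circleDegree c + (∑ c ∈ C, α.circleDegree c + ∑ c ∈ C', α.circleDegree c) =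
      α.edgeWeight := by
    rw [← sum_union hCC, hD, sum_sdiff (union_subset hC hC'), sum_circleDegree]
  have hS : (α.squares \ (A ∪ A')).card + (A.card + A'.card) = α.squares.card := by
    rw [← card_union_of_disjoint hAA, card_sdiff_add_card_eq_card (union_subset hA hA')]
  -- The two frontiers bound `|U| + |V|` by twice the number of uncoloured squares plus the label
  -- weight between `A ∪ A'` and `D`. That weight is at most what `C` and `C'` leave over of
  -- `edgeWeight`.
  have ht : 2 * α.squares.card ≤ α.edgeWeight + α.left.card + α.right.card := by
    rw [← sum_squareTotalDegree, mul_comm, ← smul_eq_mul]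
    exact card_nsmul_le_sum _ _ _ hdeg
  have hl := hleft.trans (card_union_le _ _)
  have hr := hright.trans (card_union_le _ _)
  rw [union_comm A' A] at hr
  have h2' : (A'.filter fun s => ∃ c, c ∉ C' ∧ c ∉ C ∧ α.label s c ≠ 0).card ≤
        ∑ s ∈ A', ∑ c ∈ D, α.label s c :=
    (card_le_card (monotone_filter_right _ fun s _ ⟨c, h, h', hl⟩ => ⟨c, h', h, hl⟩)).trans h2
  omega

/-- The squares outside both indices. -/
def middleSquares [DecidableEq Sq] (α : Shape Sq Ci) : Finset Sq := α.squares \ (α.left ∪ α.right)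

/-- The sum of the excesses of the total degrees of the squares over `2`. -/
noncomputable def degreeExcess (α : Shape Sq Ci) : ℕ := ∑ s ∈ α.squares, (α.squareTotalDegree s - 2)

theorem edgeWeight_add_eq {α : Shape Sq Ci} (hdeg : ∀ s ∈ α.squares, 2 ≤ α.squareTotalDegree s) :
    α.edgeWeight + α.left.card + α.right.card = 2 * α.squares.card + α.degreeExcess := by
  rw [← sum_squareTotalDegree, degreeExcess, mul_comm, ← smul_eq_mul, ← sum_const,
    ← sum_add_distrib]
  exact sum_congr rfl fun s hs => (Nat.add_sub_cancel' (hdeg s hs)).symm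

/-- A second count that uses no separators. Square by square, index memberships (with weight `2` for
squares in no index) are paid for by the degree, or by `2` if the square is uncoloured; a square in
both indices is necessarily uncoloured. -/
theorem two_mul_middle_add_excess_le [DecidableEq Sq] {α : Shape Sq Ci} {A A' : Finset Sq}
    (hA : A ⊆ α.squares) (hA' : A' ⊆ α.squares) (hAA : Disjoint A A')
    (hdeg : ∀ s ∈ α.squares, 2 ≤ α.squareTotalDegree s)
    (hleft : Disjoint α.left A') (hright : Disjoint α.right A) :
    2 * A.card + 2 * A'.card + 2 * α.middleSquares.card + α.degreeExcess ≤ 2 * α.edgeWeight := by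
  have h1 := edgeWeight_add_eq hdeg
  have hS : (α.squares \ (A ∪ A')).card + (A.card + A'.card) = α.squares.card := by
    rw [← card_union_of_disjoint hAA, card_sdiff_add_card_eq_card (union_subset hA hA')]
  have h2 : 2 * α.middleSquares.card + α.left.card + α.right.card ≤
      α.edgeWeight + 2 * (α.squares \ (A ∪ A')).card := by
    have e1 : α.middleSquares.card = ∑ s ∈ α.squares, if s ∈ α.left ∪ α.right then 0 else 1 := by
      rw [middleSquares, ← filter_notMem_eq_sdiff, card_filter]
      exact sum_congr rfl fun s _ => by split_ifs <;> simp_all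
    have e2 : α.left.card = ∑ s ∈ α.squares, if s ∈ α.left then 1 else 0 := by
      rw [Finset.sum_ite_mem, inter_eq_right.2 α.left_subset]; simp
    have e3 : α.right.card = ∑ s ∈ α.squares, if s ∈ α.right then 1 else 0 := by
      rw [Finset.sum_ite_mem, inter_eq_right.2 α.right_subset]; simp
    have e4 : (α.squares \ (A ∪ A')).card = ∑ s ∈ α.squares, if s ∈ A ∪ A' then 0 else 1 := by
      rw [← filter_notMem_eq_sdiff, card_filter]
      exact sum_congr rfl fun s _ => by split_ifs <;> simp_all
    rw [e1, e2, e3, e4, ← sum_squareDegree, mul_sum, mul_sum, ← sum_add_distrib,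
      ← sum_add_distrib, ← sum_add_distrib]
    refine sum_le_sum fun s hs => ?_
    have hd := hdeg s hs
    rw [squareTotalDegree] at hd
    have hl : s ∈ α.left → s ∉ A' := fun h => Finset.disjoint_left.1 hleft h
    have hr : s ∈ α.right → s ∉ A := fun h => Finset.disjoint_left.1 hright h
    simp only [mem_union]
    by_cases a1 : s ∈ α.left <;> by_cases a2 : s ∈ α.right <;> simp_all
    all_goals omega
  omega


/-! ### Disjoint unions of simple spiders -/

open Classical in
-- By disjointness a single spider contains `s`, and it determines both the edges at `s` and its
-- index memberships.
theorem IsSSD.squareDegree_le {α : Shape Sq Ci} (h : α.IsSSD) {s : Sq} (hs : s ∈ α.squares) :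
    α.squareDegree s ≤ if s ∈ α.left ∧ s ∈ α.right then 0 else 1 := by
  obtain ⟨r, β, hsp, hdisj, hV, hl, hr, hlab⟩ := h
  obtain ⟨t, ht⟩ := (hV (Sum.inl s)).1 (inl_mem_vertices.2 hs)
  have huniq : ∀ t', s ∈ (β t').squares → t' = t := fun t' ht' => by
    by_contra hne
    exact Finset.disjoint_left.1 (hdisj t' t hne) (inl_mem_vertices.2 ht') ht
  rw [inl_mem_vertices] at ht
  have hl' : s ∈ α.left ↔ s ∈ (β t).left :=
    (hl s).trans ⟨fun ⟨t', h⟩ => huniq t' ((β t').left_subset h) ▸ h, fun h => ⟨t, h⟩⟩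
  have hr' : s ∈ α.right ↔ s ∈ (β t).right :=
    (hr s).trans ⟨fun ⟨t', h⟩ => huniq t' ((β t').right_subset h) ▸ h, fun h => ⟨t, h⟩⟩
  have hlab' : ∀ c, α.label s c = (β t).label s c := fun c => by
    rw [hlab]
    refine Finset.sum_eq_single t (fun t' _ hne => ?_) (by simp)
    by_contra h0
    exact hne (huniq t' ((β t').mem_of_label_ne_zero s c h0).1)
  simp only [hl', hr', squareDegree, hlab']
  rcases hsp t with h | ⟨c, hc, -, h⟩
  · simp [h.2.2.2]
  · have hc' : ∀ d ≠ c, (β t).label s d = 0 := fun d hd => by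
      by_contra h0
      have := ((β t).mem_of_label_ne_zero s d h0).2
      rw [hc, mem_singleton] at this
      exact hd this
    have : ∑ d ∈ α.circles, (β t).label s d ≤ (β t).label s c := by
      by_cases hcα : c ∈ α.circles
      · exact (sum_eq_single_of_mem c hcα fun d _ hd => hc' d hd).le
      · rw [sum_eq_zero fun d hd => hc' d fun h => hcα (h ▸ hd)]
        exact Nat.zero_le _
    refine this.trans ?_
    split_ifs with hs2
    · exact ((h s ht).2 hs2).le
    · exact ((h s ht).1 hs2).le

/-- The part of `α` that consists of the circle `c` and its neighbours. -/
noncomputable def star (α : Shape Sq Ci) (c : Ci) : Shape Sq Ci := by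
  classical
  exact
  { squares := α.squares.filter fun s => α.label s c ≠ 0
    circles := {c}
    label := fun s d => if d = c then α.label s c else 0
    left := α.left.filter fun s => α.label s c ≠ 0
    right := α.right.filter fun s => α.label s c ≠ 0
    left_subset := filter_subset_filter _ α.left_subset
    right_subset := filter_subset_filter _ α.right_subset
    mem_of_label_ne_zero := fun s d h => by
      by_cases hd : d = c
      · rw [if_pos hd] at h
        exact ⟨mem_filter.2 ⟨(α.mem_of_label_ne_zero s c h).1, h⟩, mem_singleton.2 hd⟩
      · exact absurd (if_neg hd) h }

/-- The trivial shape on a set of squares. -/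
def trivialShape (T : Finset Sq) : Shape Sq Ci where
  squares := T
  circles := ∅
  label _ _ := 0
  left := T
  right := T
  left_subset := subset_rfl
  right_subset := subset_rfl
  mem_of_label_ne_zero _ _ h := absurd rfl h

/-- Each square in exactly one index has a single label-1 edge, so the stars of the circles are
disjoint spiders. The squares in both indices form one further, trivial spider, placed at index `0`.
-/
theorem isSSD_of_squareDegree {α : Shape Sq Ci}
    (hcover : ∀ s ∈ α.squares, s ∈ α.left ∨ s ∈ α.right)
    (hboth : ∀ s, s ∈ α.left → s ∈ α.right → α.squareDegree s = 0)
    (hone : ∀ s ∈ α.squares, ¬ (s ∈ α.left ∧ s ∈ α.right) → α.squareDegree s = 1) :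
    α.IsSSD := by
  classical
  let e := α.circles.equivFin
  let β : Fin (α.circles.card + 1) → Shape Sq Ci :=
    Fin.cases (trivialShape (α.left ∩ α.right)) fun t => α.star (e.symm t)
  have β0 : β 0 = trivialShape (α.left ∩ α.right) := rfl
  have βs : ∀ t, β (Fin.succ t) = α.star (e.symm t) := fun t => rfl
  have hnot : ∀ s c, α.label s c ≠ 0 → ¬ (s ∈ α.left ∧ s ∈ α.right) := fun s c h hs =>
    h (squareDegree_eq_zero_iff.1 (hboth s hs.1 hs.2) c)
  have hlab1 : ∀ s c, α.label s c ≠ 0 → α.label s c = 1 ∧ ∀ d, d ≠ c → α.label s d = 0 := by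
    intro s c h
    have hsc := α.mem_of_label_ne_zero s c h
    have hd := hone s hsc.1 (hnot s c h)
    rw [squareDegree, ← add_sum_erase _ _ hsc.2] at hd
    refine ⟨by omega, fun d hdc => ?_⟩
    by_contra h0
    have := single_le_sum (f := fun c => α.label s c) (fun _ _ => Nat.zero_le _)
      (mem_erase.2 ⟨hdc, (α.mem_of_label_ne_zero s d h0).2⟩)
    omega
  have hex : ∀ s ∈ α.squares, ¬ (s ∈ α.left ∧ s ∈ α.right) →
      ∃ t, α.label s (e.symm t) ≠ 0 := by
    intro s hs h
    have hd := hone s hs h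
    obtain ⟨c, hc, h0⟩ := exists_ne_zero_of_sum_ne_zero (hd.trans_ne one_ne_zero)
    exact ⟨e ⟨c, hc⟩, by simpa using h0⟩
  refine ⟨α.circles.card + 1, β, ?_, ?_, ?_, ?_, ?_, ?_⟩
  · refine Fin.cases ?_ fun t => ?_
    · exact Or.inl ⟨rfl, rfl, rfl, fun _ _ => rfl⟩
    · refine Or.inr ⟨e.symm t, rfl, fun s hs => ?_, fun s hs => ?_⟩
      · have hs' := mem_filter.1 hs
        exact (hcover s hs'.1).imp (fun h => mem_filter.2 ⟨h, hs'.2⟩)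
          fun h => mem_filter.2 ⟨h, hs'.2⟩
      · have hs' := mem_filter.1 hs
        refine ⟨fun _ => ?_, fun h => ?_⟩
        · exact (if_pos rfl).trans (hlab1 s _ hs'.2).1
        · exact absurd ⟨(mem_filter.1 h.1).1, (mem_filter.1 h.2).1⟩ (hnot s _ hs'.2)
  · have h0 : ∀ t, Disjoint (β 0).vertices (β (Fin.succ t)).vertices := by
      intro t
      rw [Finset.disjoint_left, β0, βs]
      rintro (s | c) h1 h2
      · simp only [inl_mem_vertices, trivialShape, star, mem_inter, mem_filter] at h1 h2
        exact hnot s _ h2.2 h1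
      · simp [trivialShape] at h1
    refine Fin.cases (Fin.cases (fun h => absurd rfl h) fun t _ => h0 t) fun t =>
      Fin.cases (fun _ => (h0 t).symm) fun t' htt => ?_
    have hne : (e.symm t : Ci) ≠ e.symm t' := fun h =>
      htt (congrArg Fin.succ (e.symm.injective (Subtype.ext h)))
    rw [Finset.disjoint_left, βs, βs]
    rintro (s | c) h1 h2
    · simp only [inl_mem_vertices, star, mem_filter] at h1 h2
      exact h1.2 ((hlab1 s _ h2.2).2 _ hne)
    · simp only [inr_mem_vertices, star, mem_singleton] at h1 h2
      exact hne (h1.symm.trans h2)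
  · rintro (s | c)
    · rw [inl_mem_vertices, Fin.exists_fin_succ, β0]
      simp only [βs, inl_mem_vertices, trivialShape, star, mem_filter, mem_inter]
      constructor
      · intro hs
        by_cases h : s ∈ α.left ∧ s ∈ α.right
        · exact Or.inl h
        · obtain ⟨t, ht⟩ := hex s hs h
          exact Or.inr ⟨t, hs, ht⟩
      · rintro (h | ⟨t, h⟩)
        exacts [α.left_subset h.1, h.1]
    · rw [inr_mem_vertices, Fin.exists_fin_succ, β0]
      simp only [βs, inr_mem_vertices, trivialShape, star, mem_singleton, notMem_empty, false_or]
      exact ⟨fun hc => ⟨e ⟨c, hc⟩, by simp⟩, fun ⟨t, ht⟩ => ht ▸ (e.symm t).2⟩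
  · intro s
    rw [Fin.exists_fin_succ, β0]
    simp only [βs, trivialShape, star, mem_filter, mem_inter]
    constructor
    · intro hs
      by_cases h : s ∈ α.right
      · exact Or.inl ⟨hs, h⟩
      · obtain ⟨t, ht⟩ := hex s (α.left_subset hs) fun h' => h h'.2
        exact Or.inr ⟨t, hs, ht⟩
    · rintro (h | ⟨t, h⟩)
      exacts [h.1, h.1]
  · intro s
    rw [Fin.exists_fin_succ, β0]
    simp only [βs, trivialShape, star, mem_filter, mem_inter]
    constructor
    · intro hs
      by_cases h : s ∈ α.left
      · exact Or.inl ⟨h, hs⟩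
      · obtain ⟨t, ht⟩ := hex s (α.right_subset hs) fun h' => h h'.1
        exact Or.inr ⟨t, hs, ht⟩
    · rintro (h | ⟨t, h⟩)
      exacts [h.2, h.1]
  · intro s c
    rw [Fin.sum_univ_succ, β0]
    simp only [βs, trivialShape, star, zero_add]
    by_cases hc : c ∈ α.circles
    · rw [Finset.sum_eq_single (e ⟨c, hc⟩)]
      · simp
      · intro t _ ht
        rw [if_neg]
        rintro rfl
        exact ht (by simp)
      · simp
    · have : α.label s c = 0 := by
        by_contra h0
        exact hc (α.mem_of_label_ne_zero s c h0).2
      rw [this, eq_comm]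
      refine sum_eq_zero fun t _ => ?_
      rw [if_neg]
      rintro rfl
      exact hc (e.symm t).2

end Shape

namespace IntersectionConfiguration

open Shape

variable {k : ℕ} (P : IntersectionConfiguration k)

/-! ### Classes of vertices -/

/-- The class of a vertex. -/
def vertexClass : ℕ ⊕ ℕ → P.SquareClass ⊕ P.CircleClass := Sum.map P.squareClass P.circleClass

@[simp] theorem vertexClass_inl (s : ℕ) : P.vertexClass (Sum.inl s) = Sum.inl (P.squareClass s) :=
  rfl

@[simp] theorem vertexClass_inr (c : ℕ) : P.vertexClass (Sum.inr c) = Sum.inr (P.circleClass c) :=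
  rfl

variable {P}

theorem squareClass_eq_iff {s t : ℕ} :
    P.squareClass s = P.squareClass t ↔ P.equiv (Sum.inl s) (Sum.inl t) :=
  Quotient.eq (r := P.equiv.comap Sum.inl)

theorem circleClass_eq_iff {c d : ℕ} :
    P.circleClass c = P.circleClass d ↔ P.equiv (Sum.inr c) (Sum.inr d) :=
  Quotient.eq (r := P.equiv.comap Sum.inr)

theorem vertexClass_eq_iff {x y : ℕ ⊕ ℕ} :
    P.vertexClass x = P.vertexClass y ↔ P.equiv x y := by
  rcases x with s | c <;> rcases y with t | d
  · simp [squareClass_eq_iff]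
  · simp only [vertexClass_inl, vertexClass_inr, reduceCtorEq, false_iff]
    exact fun h => by simpa using P.same_sort _ _ h
  · simp only [vertexClass_inl, vertexClass_inr, reduceCtorEq, false_iff]
    exact fun h => by simpa using P.same_sort _ _ h
  · simp [circleClass_eq_iff]

theorem mem_indices {i : ℤ} : i ∈ P.indices ↔ -(P.j : ℤ) ≤ i ∧ i ≤ P.j := Finset.mem_Icc

theorem mem_squares {s : ℕ} : s ∈ P.squares ↔ ∃ i ∈ P.indices, s ∈ (P.shape i).squares := by
  simp [squares]

theorem mem_circles {c : ℕ} : c ∈ P.circles ↔ ∃ i ∈ P.indices, c ∈ (P.shape i).circles := by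
  simp [circles]

theorem eq_of_vertexClass_eq {i : ℤ} (hi : i ∈ P.indices) {x y : ℕ ⊕ ℕ}
    (hx : x ∈ (P.shape i).vertices) (hy : y ∈ (P.shape i).vertices)
    (h : P.vertexClass x = P.vertexClass y) : x = y :=
  P.trivial_on_shapes i hi x hx y hy (vertexClass_eq_iff.1 h)

theorem mem_result_vertices {ξ : P.SquareClass ⊕ P.CircleClass} :
    ξ ∈ P.result.vertices ↔
      ∃ i ∈ P.indices, ∃ x ∈ (P.shape i).vertices, P.vertexClass x = ξ := by
  classical
  rcases ξ with q | r
  · simp only [inl_mem_vertices, result, mem_image, mem_squares]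
    constructor
    · rintro ⟨s, ⟨i, hi, hs⟩, rfl⟩
      exact ⟨i, hi, Sum.inl s, by simpa using hs, rfl⟩
    · rintro ⟨i, hi, s | c, hs, h⟩
      · exact ⟨s, ⟨i, hi, by simpa using hs⟩, by simpa using h⟩
      · simp at h
  · simp only [inr_mem_vertices, result, mem_image, mem_circles]
    constructor
    · rintro ⟨s, ⟨i, hi, hs⟩, rfl⟩
      exact ⟨i, hi, Sum.inr s, by simpa using hs, rfl⟩
    · rintro ⟨i, hi, s | c, hs, h⟩
      · simp at h
      · exact ⟨c, ⟨i, hi, by simpa using hs⟩, by simpa using h⟩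

theorem mem_result_left {q : P.SquareClass} :
    q ∈ P.result.left ↔ ∃ s ∈ (P.shape (-(P.j : ℤ))).left, P.squareClass s = q := by
  classical simp [result]

theorem mem_result_right {q : P.SquareClass} :
    q ∈ P.result.right ↔ ∃ s ∈ (P.shape (P.j : ℤ)).right, P.squareClass s = q := by
  classical simp [result]

/-! ### The order of the shapes -/

theorem right_eq_left {i : ℤ} (hi : i ∈ P.indices) (h : i ≠ P.j) :
    i + 1 ∈ P.indices ∧ (P.shape i).right = (P.shape (i + 1)).left := by
  rw [mem_indices] at hi ⊢
  exact ⟨by omega, P.composable i (Finset.mem_Ico.2 (by omega))⟩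

theorem left_eq_right {i : ℤ} (hi : i ∈ P.indices) (h : i ≠ -(P.j : ℤ)) :
    i - 1 ∈ P.indices ∧ (P.shape i).left = (P.shape (i - 1)).right := by
  rw [mem_indices] at hi ⊢
  refine ⟨by omega, ?_⟩
  have := P.composable (i - 1) (Finset.mem_Ico.2 (by omega))
  rw [this, sub_add_cancel]

theorem mem_right_of_lt {a b : ℤ} (ha : a ∈ P.indices) (hb : b ∈ P.indices) (hab : a < b)
    {s : ℕ} (hsa : s ∈ (P.shape a).squares) (hsb : s ∈ (P.shape b).squares) :
    s ∈ (P.shape a).right := by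
  have h1 := P.no_other_identification a ha b hb hab (Sum.inl s) (by simpa using hsa)
    (by simpa using hsb) (a + 1) (Finset.mem_Ioc.2 (by omega))
  have hne : a ≠ P.j := by rw [mem_indices] at hb; omega
  rw [(right_eq_left ha hne).2]
  simpa using h1

theorem mem_left_of_lt {a b : ℤ} (ha : a ∈ P.indices) (hb : b ∈ P.indices) (hab : a < b)
    {s : ℕ} (hsa : s ∈ (P.shape a).squares) (hsb : s ∈ (P.shape b).squares) :
    s ∈ (P.shape b).left := by
  simpa using P.no_other_identification a ha b hb hab (Sum.inl s) (by simpa using hsa)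
    (by simpa using hsb) b (Finset.mem_Ioc.2 (by omega))

theorem eq_of_mem_circles {a b : ℤ} (ha : a ∈ P.indices) (hb : b ∈ P.indices)
    {c : ℕ} (hca : c ∈ (P.shape a).circles) (hcb : c ∈ (P.shape b).circles) : a = b := by
  have key : ∀ a ∈ P.indices, ∀ b ∈ P.indices, c ∈ (P.shape a).circles →
      c ∈ (P.shape b).circles → ¬ a < b := fun a ha b hb hca hcb hab =>
    inr_notMem_leftSet (P.no_other_identification a ha b hb hab (Sum.inr c) (by simpa using hca)
      (by simpa using hcb) b (Finset.mem_Ioc.2 (by omega)))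
  exact le_antisymm (not_lt.1 (key b hb a ha hcb hca)) (not_lt.1 (key a ha b hb hca hcb))

/-! ### Edges of the result -/

/-- Equivalence is trivial within a shape, so all but one factor of the Hermite product equal `h_0 =
1`. -/
theorem result_label_eq_of_unique {i : ℤ} (hi : i ∈ P.indices) {s c : ℕ}
    (hs : s ∈ (P.shape i).squares) (hc : c ∈ (P.shape i).circles)
    (huniq : ∀ i' ∈ P.indices, i' ≠ i → ∀ s' c', (P.shape i').label s' c' ≠ 0 →
      P.squareClass s' = P.squareClass s → P.circleClass c' ≠ P.circleClass c) :
    P.result.label (P.squareClass s) (P.circleClass c) = (P.shape i).label s c := by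
  classical
  change minHermiteIndex (P.hermiteProduct _ _) = _
  rw [hermiteProduct, prod_eq_single_of_mem i hi, prod_eq_single_of_mem s,
    prod_eq_single_of_mem c, minHermiteIndex_hermite]
  · exact mem_filter.2 ⟨hc, rfl⟩
  · intro d hd hne
    rw [mem_filter] at hd
    exact absurd (Sum.inr.inj (eq_of_vertexClass_eq hi (inr_mem_vertices.2 hd.1)
      (inr_mem_vertices.2 hc) (congrArg Sum.inr hd.2))) hne
  · exact mem_filter.2 ⟨hs, rfl⟩
  · intro t ht hne
    rw [mem_filter] at ht
    exact absurd (Sum.inl.inj (eq_of_vertexClass_eq hi (inl_mem_vertices.2 ht.1)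
      (inl_mem_vertices.2 hs) (congrArg Sum.inl ht.2))) hne
  · intro i' hi' hne
    refine prod_eq_one fun s' hs' => prod_eq_one fun c' hc' => ?_
    rw [mem_filter] at hs' hc'
    by_cases h0 : (P.shape i').label s' c' = 0
    · rw [h0, Polynomial.hermite_zero, map_one]
    · exact absurd hc'.2 (huniq i' hi' hne s' c' h0 hs'.2)

/-- An edge between two classes of vertices that do not meet in any other shape survives. -/
theorem result_adj_of_unique {i : ℤ} (hi : i ∈ P.indices) {x y : ℕ ⊕ ℕ}
    (h : (P.shape i).graph.Adj x y)
    (huniq : ∀ i' ∈ P.indices, i' ≠ i → ∀ x' ∈ (P.shape i').vertices,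
      ∀ y' ∈ (P.shape i').vertices, P.vertexClass x' = P.vertexClass x →
        P.vertexClass y' ≠ P.vertexClass y) :
    P.result.graph.Adj (P.vertexClass x) (P.vertexClass y) := by
  have hx := mem_vertices_of_adj h
  have hy := mem_vertices_of_adj h.symm
  rcases x with s | c <;> rcases y with t | d
  · simp at h
  · rw [inl_mem_vertices] at hx
    rw [inr_mem_vertices] at hy
    rw [vertexClass_inl, vertexClass_inr, graph_adj_inl_inr, result_label_eq_of_unique hi hx hy]
    · simpa using h
    · intro i' hi' hne s' c' h0 h1 h2
      obtain ⟨hs', hc'⟩ := (P.shape i').mem_of_label_ne_zero s' c' h0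
      exact huniq i' hi' hne (Sum.inl s') (by simpa using hs') (Sum.inr c') (by simpa using hc')
        (congrArg Sum.inl h1) (congrArg Sum.inr h2)
  · rw [inr_mem_vertices] at hx
    rw [inl_mem_vertices] at hy
    rw [vertexClass_inl, vertexClass_inr, graph_adj_inr_inl, result_label_eq_of_unique hi hy hx]
    · simpa using h
    · intro i' hi' hne s' c' h0 h1 h2
      obtain ⟨hs', hc'⟩ := (P.shape i').mem_of_label_ne_zero s' c' h0
      exact huniq i' hi' hne (Sum.inr c') (by simpa using hc') (Sum.inl s') (by simpa using hs')
        (congrArg Sum.inr h2) (congrArg Sum.inl h1)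
  · simp at h

theorem exists_label_ne_zero_of_result {q : P.SquareClass} {r : P.CircleClass}
    (h : P.result.label q r ≠ 0) : ∃ i ∈ P.indices, ∃ s c, (P.shape i).label s c ≠ 0 ∧
      P.squareClass s = q ∧ P.circleClass c = r := by
  classical
  by_contra! hcon
  apply h
  change minHermiteIndex (P.hermiteProduct q r) = 0
  have h1 : P.hermiteProduct q r = 1 := by
    refine prod_eq_one fun i hi => prod_eq_one fun s hs => prod_eq_one fun c hc => ?_
    rw [mem_filter] at hs hc
    have h0 : (P.shape i).label s c = 0 := by
      by_contra h0
      exact hcon i hi s c h0 hs.2 hc.2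
    rw [h0, Polynomial.hermite_zero, map_one]
  rw [h1, minHermiteIndex_one]

theorem mem_isolated_result {ξ : P.SquareClass ⊕ P.CircleClass} : ξ ∈ P.result.isolated ↔
    ξ ∈ P.result.vertices ∧ ξ ∉ P.result.leftSet ∧ ξ ∉ P.result.rightSet ∧
      ∀ η, ¬ P.result.graph.Adj ξ η := by
  classical simp [isolated]

/-! ### The colouring induced by a separator of the result -/

variable (P)

/-- `ξ` can be reached from the left index of the result by a walk that avoids `S`. -/
def Reachable (S : Finset (P.SquareClass ⊕ P.CircleClass)) (ξ : P.SquareClass ⊕ P.CircleClass) :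
    Prop :=
  ∃ η ∈ P.result.leftSet, ∃ p : P.result.graph.Walk η ξ, ∀ ζ ∈ p.support, ζ ∉ S

open Classical in
/-- The classes on the left of the separator `S`, and the isolated classes. -/
noncomputable def leftSide (S : Finset (P.SquareClass ⊕ P.CircleClass)) :
    Finset (P.SquareClass ⊕ P.CircleClass) :=
  P.result.vertices.filter fun ξ => ξ ∈ P.result.isolated ∨ ξ ∉ S ∧ P.Reachable S ξ

open Classical in
/-- The classes on the right of the separator `S`, and the isolated classes. -/
noncomputable def rightSide (S : Finset (P.SquareClass ⊕ P.CircleClass)) :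
    Finset (P.SquareClass ⊕ P.CircleClass) :=
  P.result.vertices.filter fun ξ => ξ ∈ P.result.isolated ∨ ξ ∉ S ∧ ¬ P.Reachable S ξ

open Classical in
/-- The vertices of the `i`-th shape with class in `K`, all of whose equivalent vertices lie in shapes
with smaller or equal value of `φ`. -/
noncomputable def extremal (φ : ℤ → ℤ) (K : Finset (P.SquareClass ⊕ P.CircleClass)) (i : ℤ) :
    Finset (ℕ ⊕ ℕ) :=
  (P.shape i).vertices.filter fun x => P.vertexClass x ∈ K ∧ ∀ i' ∈ P.indices,
    ∀ x' ∈ (P.shape i').vertices, P.vertexClass x' = P.vertexClass x → φ i' ≤ φ i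

/-- The vertices of the `i`-th shape coloured left: the rightmost vertices of the classes on the left
of `S`. -/
noncomputable def leftColor (S : Finset (P.SquareClass ⊕ P.CircleClass)) (i : ℤ) :
    Finset (ℕ ⊕ ℕ) :=
  P.extremal (fun i => i) (P.leftSide S) i

/-- The vertices of the `i`-th shape coloured right: the leftmost vertices of the classes on the right
of `S`. -/
noncomputable def rightColor (S : Finset (P.SquareClass ⊕ P.CircleClass)) (i : ℤ) :
    Finset (ℕ ⊕ ℕ) :=
  P.extremal (fun i => -i) (P.rightSide S) i

variable {P}

/-- Every class has a representative in a shape with maximal `φ`, and passing to classes preserves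
vertex weights. -/
theorem weight_le_sum_extremal {n m : ℕ} (hω : 0 ≤ Real.logb n m) (φ : ℤ → ℤ)
    {K : Finset (P.SquareClass ⊕ P.CircleClass)} (hK : K ⊆ P.result.vertices) :
    weight n m K ≤ ∑ i ∈ P.indices, weight n m (P.extremal φ K i) := by
  classical
  have hsub : K ⊆ (P.indices.sigma fun i => P.extremal φ K i).image
      fun z => P.vertexClass z.2 := by
    intro ξ hξ
    have hne : (P.indices.filter fun i => ∃ x ∈ (P.shape i).vertices,
        P.vertexClass x = ξ).Nonempty := by
      obtain ⟨i, hi, h⟩ := mem_result_vertices.1 (hK hξ)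
      exact ⟨i, mem_filter.2 ⟨hi, h⟩⟩
    obtain ⟨i, hi₀, hmax⟩ := exists_max_image _ φ hne
    obtain ⟨hi, x, hx, rfl⟩ := mem_filter.1 hi₀
    refine mem_image.2 ⟨⟨i, x⟩, mem_sigma.2 ⟨hi, mem_filter.2 ⟨hx, hξ, ?_⟩⟩, rfl⟩
    exact fun i' hi' x' hx' h => hmax i' (mem_filter.2 ⟨hi', x', hx', h⟩)
  have hw : ∀ x, vertexWeight n m (P.vertexClass x) = vertexWeight n m x := by
    rintro (s | c) <;> rfl
  have hw0 : ∀ {A B : Type} (x : A ⊕ B), 0 ≤ vertexWeight n m x := by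
    rintro A B (s | c) <;> simp [vertexWeight, hω]
  calc weight n m K ≤ ∑ ξ ∈ (P.indices.sigma fun i => P.extremal φ K i).image
        fun z => P.vertexClass z.2, vertexWeight n m ξ :=
        sum_le_sum_of_subset_of_nonneg hsub fun x _ _ => hw0 x
    _ ≤ ∑ z ∈ P.indices.sigma fun i => P.extremal φ K i, vertexWeight n m (P.vertexClass z.2) :=
        sum_image_le_of_nonneg fun z _ => hw0 _
    _ = ∑ i ∈ P.indices, weight n m (P.extremal φ K i) := by
        rw [sum_sigma]
        simp only [hw, weight]

theorem mem_leftColor {S : Finset (P.SquareClass ⊕ P.CircleClass)} {i : ℤ} {x : ℕ ⊕ ℕ} :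
    x ∈ P.leftColor S i ↔ x ∈ (P.shape i).vertices ∧ P.vertexClass x ∈ P.leftSide S ∧
      ∀ i' ∈ P.indices, ∀ x' ∈ (P.shape i').vertices,
        P.vertexClass x' = P.vertexClass x → i' ≤ i := by
  classical simp [leftColor, extremal]

theorem mem_rightColor {S : Finset (P.SquareClass ⊕ P.CircleClass)} {i : ℤ} {x : ℕ ⊕ ℕ} :
    x ∈ P.rightColor S i ↔ x ∈ (P.shape i).vertices ∧ P.vertexClass x ∈ P.rightSide S ∧
      ∀ i' ∈ P.indices, ∀ x' ∈ (P.shape i').vertices,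
        P.vertexClass x' = P.vertexClass x → i ≤ i' := by
  classical simp [rightColor, extremal]

theorem mem_leftSide {S : Finset (P.SquareClass ⊕ P.CircleClass)}
    {ξ : P.SquareClass ⊕ P.CircleClass} : ξ ∈ P.leftSide S ↔ ξ ∈ P.result.vertices ∧
      (ξ ∈ P.result.isolated ∨ ξ ∉ S ∧ P.Reachable S ξ) := by
  classical simp [leftSide]

theorem mem_rightSide {S : Finset (P.SquareClass ⊕ P.CircleClass)}
    {ξ : P.SquareClass ⊕ P.CircleClass} : ξ ∈ P.rightSide S ↔ ξ ∈ P.result.vertices ∧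
      (ξ ∈ P.result.isolated ∨ ξ ∉ S ∧ ¬ P.Reachable S ξ) := by
  classical simp [rightSide]

variable {S : Finset (P.SquareClass ⊕ P.CircleClass)}

theorem Reachable.of_adj {ξ η : P.SquareClass ⊕ P.CircleClass} (h : P.Reachable S ξ)
    (hadj : P.result.graph.Adj ξ η) (hη : η ∉ S) : P.Reachable S η := by
  obtain ⟨ζ, hζ, p, hp⟩ := h
  refine ⟨ζ, hζ, p.concat hadj, fun z hz => ?_⟩
  rw [SimpleGraph.Walk.support_concat, List.mem_append] at hz
  rcases hz with hz | hz
  · exact hp z hz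
  · rw [List.mem_singleton] at hz
    exact hz ▸ hη

/-- Isolated classes lie on both sides, which accounts for their double weight; every other class
outside `S` lies on exactly one side. -/
theorem weight_le_weight_sides {n m : ℕ} (hω : 0 ≤ Real.logb n m) (hS : S ⊆ P.result.vertices) :
    weight n m P.result.vertices + weight n m P.result.isolated - weight n m S ≤
      weight n m (P.leftSide S) + weight n m (P.rightSide S) := by
  classical
  have hI : P.result.isolated ⊆ P.result.vertices := fun ξ hξ => (mem_isolated_result.1 hξ).1
  have hL : P.leftSide S ⊆ P.result.vertices := fun ξ hξ => (mem_leftSide.1 hξ).1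
  have hR : P.rightSide S ⊆ P.result.vertices := fun ξ hξ => (mem_rightSide.1 hξ).1
  have key : ∀ T ⊆ P.result.vertices, weight n m T =
      ∑ ξ ∈ P.result.vertices, if ξ ∈ T then vertexWeight n m ξ else 0 := by
    intro T hT
    rw [sum_ite_mem, inter_eq_right.2 hT, weight]
  rw [sub_le_iff_le_add, key _ hI, key _ hS, key _ hL, key _ hR, weight, ← sum_add_distrib,
    ← sum_add_distrib, ← sum_add_distrib]
  refine sum_le_sum fun ξ hξ => ?_
  have hw : 0 ≤ vertexWeight n m ξ := by rcases ξ with s | c <;> simp [vertexWeight, hω]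
  simp only [mem_leftSide, mem_rightSide, hξ, true_and]
  by_cases h1 : ξ ∈ P.result.isolated <;> by_cases h2 : ξ ∈ S <;>
    by_cases h3 : P.Reachable S ξ <;> simp [h1, h2, h3] <;> linarith

/-- The class of `x` occurs only up to shape `i` and that of `y` only from shape `i` on, so the edge
is not merged with another one and survives. Its ends are then not isolated, and reachability would
pass from one to the other. -/
theorem not_adj_leftColor_rightColor {i : ℤ} (hi : i ∈ P.indices) {x y : ℕ ⊕ ℕ}
    (hx : x ∈ P.leftColor S i) (hy : y ∈ P.rightColor S i) : ¬ (P.shape i).graph.Adj x y := by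
  intro h
  rw [mem_leftColor] at hx
  rw [mem_rightColor] at hy
  have hadj := result_adj_of_unique hi h fun i' hi' hne x' hx' y' hy' h1 h2 =>
    hne (le_antisymm (hx.2.2 i' hi' x' hx' h1) (hy.2.2 i' hi' y' hy' h2))
  rcases (mem_leftSide.1 hx.2.1).2 with h1 | h1
  · exact (mem_isolated_result.1 h1).2.2.2 _ hadj
  · rcases (mem_rightSide.1 hy.2.1).2 with h2 | h2
    · exact (mem_isolated_result.1 h2).2.2.2 _ hadj.symm
    · exact h2.2 (h1.2.of_adj hadj h2.1)

/-- Such a square also lies in the preceding shape and so is not leftmost, unless `i = -j`; there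
its class is in the left index of the result and is reachable by the trivial walk if it is not in
`S`. -/
theorem notMem_rightColor_of_mem_left {i : ℤ} (hi : i ∈ P.indices) {s : ℕ}
    (hs : s ∈ (P.shape i).left) : Sum.inl s ∉ P.rightColor S i := by
  intro h
  rw [mem_rightColor] at h
  by_cases hij : i = -(P.j : ℤ)
  · have hl : P.vertexClass (Sum.inl s) ∈ P.result.leftSet :=
      inl_mem_leftSet.2 (mem_result_left.2 ⟨s, hij ▸ hs, rfl⟩)
    rcases (mem_rightSide.1 h.2.1).2 with h1 | h1
    · exact (mem_isolated_result.1 h1).2.1 hl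
    · exact h1.2 ⟨_, hl, .nil, fun ζ hζ => by
        rw [SimpleGraph.Walk.support_nil, List.mem_singleton] at hζ
        exact hζ ▸ h1.1⟩
  · obtain ⟨hi', h'⟩ := left_eq_right hi hij
    have := h.2.2 (i - 1) hi' (Sum.inl s)
      (inl_mem_vertices.2 ((P.shape _).right_subset (h' ▸ hs))) rfl
    omega

theorem notMem_leftColor_of_mem_right (hsep : P.result.IsVertexSeparator S) {i : ℤ}
    (hi : i ∈ P.indices) {s : ℕ} (hs : s ∈ (P.shape i).right) :
    Sum.inl s ∉ P.leftColor S i := by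
  intro h
  rw [mem_leftColor] at h
  by_cases hij : i = P.j
  · have hl : P.vertexClass (Sum.inl s) ∈ P.result.rightSet :=
      inl_mem_rightSet.2 (mem_result_right.2 ⟨s, hij ▸ hs, rfl⟩)
    rcases (mem_leftSide.1 h.2.1).2 with h1 | ⟨-, η, hη, p, hp⟩
    · exact (mem_isolated_result.1 h1).2.2.1 hl
    · obtain ⟨ζ, hζ, hζS⟩ := hsep.2.exists_mem_of_walk hη hl p
      exact hp ζ hζ hζS
  · obtain ⟨hi', h'⟩ := right_eq_left hi hij
    have := h.2.2 (i + 1) hi' (Sum.inl s)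
      (inl_mem_vertices.2 ((P.shape _).left_subset (h' ▸ hs))) rfl
    omega

theorem mem_isolated_of_mem_sides {ξ : P.SquareClass ⊕ P.CircleClass} (h : ξ ∈ P.leftSide S)
    (h' : ξ ∈ P.rightSide S) : ξ ∈ P.result.isolated := by
  rcases (mem_leftSide.1 h).2 with h1 | h1
  · exact h1
  · exact (mem_rightSide.1 h').2.resolve_right fun h2 => h2.2 h1.2

/-- The class of a vertex with both colours is isolated and occurs only in shape `i`. But the degree
conditions give the vertex an edge, which survives. -/
theorem disjoint_leftColor_rightColor (hk : 0 < k) {i : ℤ} (hi : i ∈ P.indices) :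
    Disjoint (P.leftColor S i) (P.rightColor S i) := by
  refine Finset.disjoint_left.2 fun x hx hx' => ?_
  have hadj : ∃ y, (P.shape i).graph.Adj x y := by
    rcases x with s | c
    · have hs := inl_mem_vertices.1 (mem_leftColor.1 hx).1
      obtain ⟨c, hc⟩ := exists_label_ne_zero_of_notMem (P.two_le_totalDegree i hi s hs)
        fun h => notMem_rightColor_of_mem_left hi h.1 hx'
      exact ⟨Sum.inr c, by simpa using hc⟩
    · have hc := inr_mem_vertices.1 (mem_leftColor.1 hx).1
      obtain ⟨s, hs⟩ := exists_label_ne_zero_of_circleDegree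
        (hk.trans_le (P.le_circleDegree i hi c hc))
      exact ⟨Sum.inl s, by simpa using hs⟩
  obtain ⟨y, hy⟩ := hadj
  rw [mem_leftColor] at hx
  rw [mem_rightColor] at hx'
  have h := result_adj_of_unique hi hy fun i' hi' hne x' hxi' y' _ h1 _ =>
    hne (le_antisymm (hx.2.2 i' hi' x' hxi' h1) (hx'.2.2 i' hi' x' hxi' h1))
  exact (mem_isolated_result.1 (mem_isolated_of_mem_sides hx.2.1 hx'.2.1)).2.2.2 _ h


/-! ### Bounds for the single shapes -/

variable (P S) in
/-- The square separator of the `i`-th shape on the left side. -/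
noncomputable def leftFrontier (i : ℤ) : Finset ℕ :=
  (P.shape i).frontier (P.leftColor S i).toLeft (P.rightColor S i).toLeft
    (P.leftColor S i).toRight (P.rightColor S i).toRight

variable (P S) in
/-- The square separator of the `i`-th shape on the right side. -/
noncomputable def rightFrontier (i : ℤ) : Finset ℕ :=
  (P.shape i).frontier (P.rightColor S i).toLeft (P.leftColor S i).toLeft
    (P.rightColor S i).toRight (P.leftColor S i).toRight

theorem leftColor_toLeft_subset (i : ℤ) : (P.leftColor S i).toLeft ⊆ (P.shape i).squares :=
  fun _ hs => inl_mem_vertices.1 (mem_leftColor.1 (mem_toLeft.1 hs)).1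

theorem rightColor_toLeft_subset (i : ℤ) : (P.rightColor S i).toLeft ⊆ (P.shape i).squares :=
  fun _ hs => inl_mem_vertices.1 (mem_rightColor.1 (mem_toLeft.1 hs)).1

theorem leftColor_toRight_subset (i : ℤ) : (P.leftColor S i).toRight ⊆ (P.shape i).circles :=
  fun _ hc => inr_mem_vertices.1 (mem_leftColor.1 (mem_toRight.1 hc)).1

theorem rightColor_toRight_subset (i : ℤ) : (P.rightColor S i).toRight ⊆ (P.shape i).circles :=
  fun _ hc => inr_mem_vertices.1 (mem_rightColor.1 (mem_toRight.1 hc)).1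

theorem isSquareSeparator_leftFrontier {i : ℤ} (hi : i ∈ P.indices) {Y : Set (ℕ ⊕ ℕ)}
    (hY : ∀ x ∈ P.leftColor S i, x ∉ Y) :
    (P.shape i).IsSquareSeparator (P.shape i).leftSet Y (P.leftFrontier S i) := by
  refine isSquareSeparator_frontier (leftColor_toLeft_subset i) ?_ ?_ ?_
    (fun s hs => hY _ (mem_toLeft.1 hs)) fun c hc => hY _ (mem_toRight.1 hc)
  · intro s hs c hc
    by_contra h
    exact not_adj_leftColor_rightColor hi (mem_toLeft.1 hs) (mem_toRight.1 hc) (by simpa using h)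
  · intro s hs c hc
    by_contra h
    exact not_adj_leftColor_rightColor hi (mem_toRight.1 hc) (mem_toLeft.1 hs) (by simpa using h)
  · rintro _ ⟨s, hs, rfl⟩
    exact ⟨s, (P.shape i).left_subset hs,
      fun h => notMem_rightColor_of_mem_left hi hs (mem_toLeft.1 h), rfl⟩

theorem isSquareSeparator_rightFrontier (hsep : P.result.IsVertexSeparator S) {i : ℤ}
    (hi : i ∈ P.indices) {Y : Set (ℕ ⊕ ℕ)} (hY : ∀ x ∈ P.rightColor S i, x ∉ Y) :
    (P.shape i).IsSquareSeparator (P.shape i).rightSet Y (P.rightFrontier S i) := by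
  refine isSquareSeparator_frontier (rightColor_toLeft_subset i) ?_ ?_ ?_
    (fun s hs => hY _ (mem_toLeft.1 hs)) fun c hc => hY _ (mem_toRight.1 hc)
  · intro s hs c hc
    by_contra h
    exact not_adj_leftColor_rightColor hi (mem_toRight.1 hc) (mem_toLeft.1 hs) (by simpa using h)
  · intro s hs c hc
    by_contra h
    exact not_adj_leftColor_rightColor hi (mem_toLeft.1 hs) (mem_toRight.1 hc) (by simpa using h)
  · rintro _ ⟨s, hs, rfl⟩
    exact ⟨s, (P.shape i).right_subset hs,
      fun h => notMem_leftColor_of_mem_right hsep hi hs (mem_toLeft.1 h), rfl⟩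

theorem notMem_rightSet_of_mem_leftColor (hsep : P.result.IsVertexSeparator S) {i : ℤ}
    (hi : i ∈ P.indices) {x : ℕ ⊕ ℕ} (hx : x ∈ P.leftColor S i) : x ∉ (P.shape i).rightSet := by
  rintro ⟨s, hs, rfl⟩
  exact notMem_leftColor_of_mem_right hsep hi hs hx

theorem notMem_leftSet_of_mem_rightColor {i : ℤ}
    (hi : i ∈ P.indices) {x : ℕ ⊕ ℕ} (hx : x ∈ P.rightColor S i) : x ∉ (P.shape i).leftSet := by
  rintro ⟨s, hs, rfl⟩
  exact notMem_rightColor_of_mem_left hi hs hx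

/-- For `i < 0` this is where intersection-separation enters: a left-coloured vertex is rightmost in
its class, so it is not equivalent to a vertex of the shapes in `(i, -i]`. For `i ≥ 0` minimality of
the left index among the ordinary square separators suffices. -/
theorem card_left_le_card_leftFrontier (hsep : P.result.IsVertexSeparator S) {i : ℤ}
    (hi : i ∈ P.indices) : (P.shape i).left.card ≤ (P.leftFrontier S i).card := by
  have hr := fun x hx => notMem_rightSet_of_mem_leftColor (x := x) hsep hi hx
  rw [mem_indices] at hi
  rcases lt_trichotomy i 0 with h | rfl | h
  · have hsl := P.separation_left (-i) (Finset.mem_Icc.2 (by omega))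
    rw [neg_neg] at hsl
    refine hsl.2 _ (isSquareSeparator_leftFrontier (mem_indices.2 hi) fun x hx => ?_)
    rintro (⟨-, -, i', hi', y, hy, hxy⟩ | h')
    · rw [Finset.mem_Ioc] at hi'
      have := (mem_leftColor.1 hx).2.2 i' (mem_indices.2 (by omega)) y hy
        (vertexClass_eq_iff.2 hxy).symm
      omega
    · exact hr x hx h'
  · exact P.isMiddle.1.2 _ (isSquareSeparator_leftFrontier (mem_indices.2 hi) hr)
  · have h' := (P.isRight i (Finset.mem_Icc.2 (by omega))).1
    have hs := isSquareSeparator_leftFrontier (S := S) (mem_indices.2 hi) hr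
    exact h'.2 _ ⟨hs.1, hs.2.symm⟩

theorem card_right_le_card_rightFrontier (hsep : P.result.IsVertexSeparator S) {i : ℤ}
    (hi : i ∈ P.indices) : (P.shape i).right.card ≤ (P.rightFrontier S i).card := by
  have hr := fun x hx => notMem_leftSet_of_mem_rightColor (S := S) (x := x) hi hx
  have hs := isSquareSeparator_rightFrontier hsep hi hr
  rw [mem_indices] at hi
  rcases lt_trichotomy i 0 with h | rfl | h
  · exact (P.isLeft i (Finset.mem_Icc.2 (by omega))).1.2 _ ⟨hs.1, hs.2.symm⟩
  · exact P.isMiddle.2.2 _ ⟨hs.1, hs.2.symm⟩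
  · have hs := isSquareSeparator_rightFrontier (S := S) hsep (mem_indices.2 hi)
      (Y := (P.shape i).leftSet ∪ {x | x ∈ (P.shape i).vertices ∧ x ∉ (P.shape i).leftSet ∧
        ∃ i' ∈ Finset.Ico (-i) i, ∃ y ∈ (P.shape i').vertices, P.equiv x y}) fun x hx => by
      rintro (h' | ⟨-, -, i', hi', y, hy, hxy⟩)
      · exact hr x hx h'
      · rw [Finset.mem_Ico] at hi'
        have := (mem_rightColor.1 hx).2.2 i' (mem_indices.2 (by omega)) y hy
          (vertexClass_eq_iff.2 hxy).symm
        omega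
    exact (P.separation_right i (Finset.mem_Icc.2 (by omega))).2 _ ⟨hs.1, hs.2.symm⟩

theorem disjoint_color_toLeft (hk : 0 < k) {i : ℤ} (hi : i ∈ P.indices) :
    Disjoint (P.leftColor S i).toLeft (P.rightColor S i).toLeft :=
  Finset.disjoint_left.2 fun _ h h' => Finset.disjoint_left.1
    (disjoint_leftColor_rightColor hk hi) (mem_toLeft.1 h) (mem_toLeft.1 h')

theorem disjoint_color_toRight (hk : 0 < k) {i : ℤ} (hi : i ∈ P.indices) :
    Disjoint (P.leftColor S i).toRight (P.rightColor S i).toRight :=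
  Finset.disjoint_left.2 fun _ h h' => Finset.disjoint_left.1
    (disjoint_leftColor_rightColor hk hi) (mem_toRight.1 h) (mem_toRight.1 h')

theorem color_add_circles_le (hk : 0 < k) (hsep : P.result.IsVertexSeparator S) {i : ℤ}
    (hi : i ∈ P.indices) :
    2 * ((P.leftColor S i).toLeft.card + (P.rightColor S i).toLeft.card) +
      k * ((P.leftColor S i).toRight.card + (P.rightColor S i).toRight.card) ≤
      2 * (P.shape i).edgeWeight := by
  have h := le_two_mul_edgeWeight (leftColor_toLeft_subset (S := S) i)
    (rightColor_toLeft_subset (S := S) i) (disjoint_color_toLeft hk hi)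
    (leftColor_toRight_subset (S := S) i) (rightColor_toRight_subset (S := S) i)
    (disjoint_color_toRight hk hi)
    (P.two_le_totalDegree i hi) (card_left_le_card_leftFrontier hsep hi)
    (card_right_le_card_rightFrontier hsep hi)
  have h1 := card_nsmul_le_sum (P.leftColor S i).toRight (P.shape i).circleDegree k
    fun c hc => P.le_circleDegree i hi c (leftColor_toRight_subset i hc)
  have h2 := card_nsmul_le_sum (P.rightColor S i).toRight (P.shape i).circleDegree k
    fun c hc => P.le_circleDegree i hi c (rightColor_toRight_subset i hc)
  rw [smul_eq_mul] at h1 h2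
  linarith

theorem color_add_middle_le (hk : 0 < k) (hsep : P.result.IsVertexSeparator S) {i : ℤ}
    (hi : i ∈ P.indices) :
    2 * ((P.leftColor S i).toLeft.card + (P.rightColor S i).toLeft.card) +
      (2 * (P.shape i).middleSquares.card + (P.shape i).degreeExcess) ≤
      2 * (P.shape i).edgeWeight := by
  have h := two_mul_middle_add_excess_le (leftColor_toLeft_subset (S := S) i)
    (rightColor_toLeft_subset (S := S) i) (disjoint_color_toLeft hk hi)
    (P.two_le_totalDegree i hi)
    (Finset.disjoint_left.2 fun s hs h =>
      notMem_rightColor_of_mem_left hi hs (mem_toLeft.1 h))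
    (Finset.disjoint_left.2 fun s hs h =>
      notMem_leftColor_of_mem_right hsep hi hs (mem_toLeft.1 h))
  linarith

/-! ### The total size -/

/-- Index sizes cannot shrink outwards, and equality on both sides would make both shapes trivial by
`IsLeft.isTrivial`. -/
theorem card_index_lt {i : ℕ} (hi : i < P.j) :
    (P.shape (-(i : ℤ))).left.card + (P.shape i).right.card <
      (P.shape (-((i + 1 : ℕ) : ℤ))).left.card + (P.shape ((i + 1 : ℕ) : ℤ)).right.card := by
  have hL := P.isLeft (-((i + 1 : ℕ) : ℤ)) (Finset.mem_Icc.2 (by omega))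
  have hR := P.isRight ((i + 1 : ℕ) : ℤ) (Finset.mem_Icc.2 (by omega))
  have e1 := P.composable (-((i + 1 : ℕ) : ℤ)) (Finset.mem_Ico.2 (by omega))
  have e2 := P.composable (i : ℤ) (Finset.mem_Ico.2 (by omega))
  have e3 : -((i + 1 : ℕ) : ℤ) + 1 = -(i : ℤ) := by push_cast; ring
  have e4 : (i : ℤ) + 1 = ((i + 1 : ℕ) : ℤ) := by push_cast; ring
  rw [e3] at e1
  rw [e4] at e2
  have h1 : (P.shape (-((i + 1 : ℕ) : ℤ))).right.card ≤ _ := hL.card_right_le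
  have h2 : (P.shape ((i + 1 : ℕ) : ℤ)).left.card ≤ (P.shape ((i + 1 : ℕ) : ℤ)).right.card :=
    hR.card_right_le
  rw [← e1, e2]
  by_contra hcon
  refine P.not_both_trivial ((i + 1 : ℕ) : ℤ) (Finset.mem_Icc.2 (by omega)) ⟨?_, ?_⟩
  · exact hL.isTrivial (by omega)
  · refine (IsLeft.isTrivial hR ?_).of_transpose
    change (P.shape ((i + 1 : ℕ) : ℤ)).right.card ≤ (P.shape ((i + 1 : ℕ) : ℤ)).left.card
    omega

variable (P) in
/-- The sum of the sizes of all index sets. -/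
def boundarySize : ℕ :=
  ∑ i ∈ range (P.j + 1), ((P.shape (-(i : ℤ))).left.card + (P.shape i).right.card)

theorem card_result_left : P.result.left.card = (P.shape (-(P.j : ℤ))).left.card := by
  classical
  refine card_image_of_injOn fun s hs t ht h => ?_
  have hi : -(P.j : ℤ) ∈ P.indices := mem_indices.2 (by omega)
  exact Sum.inl.inj (eq_of_vertexClass_eq hi (inl_mem_vertices.2 ((P.shape _).left_subset hs))
    (inl_mem_vertices.2 ((P.shape _).left_subset ht)) (congrArg Sum.inl h))

theorem card_result_right : P.result.right.card = (P.shape (P.j : ℤ)).right.card := by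
  classical
  refine card_image_of_injOn fun s hs t ht h => ?_
  have hi : (P.j : ℤ) ∈ P.indices := mem_indices.2 (by omega)
  exact Sum.inl.inj (eq_of_vertexClass_eq hi (inl_mem_vertices.2 ((P.shape _).right_subset hs))
    (inl_mem_vertices.2 ((P.shape _).right_subset ht)) (congrArg Sum.inl h))

theorem boundarySize_le : P.boundarySize ≤ 3 * P.sideSize ^ 2 := by
  set u : ℕ → ℕ := fun i => (P.shape (-(i : ℤ))).left.card + (P.shape i).right.card with hu
  -- A strictly increasing sequence of naturals ending in `u i` sums to at most `1 + ⋯ + u i`. The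
  -- bound `i ≤ u i` is kept in order to get `1 ≤ D_side`, which allows `D(2D + 1) ≤ 3D²`.
  have key : ∀ i ≤ P.j, i ≤ u i ∧ 2 * ∑ l ∈ range (i + 1), u l ≤ u i * (u i + 1) := by
    intro i
    induction i with
    | zero =>
      refine fun _ => ⟨Nat.zero_le _, ?_⟩
      rw [zero_add, sum_range_one]
      rcases Nat.eq_zero_or_pos (u 0) with h | h
      · simp [h]
      · nlinarith
    | succ i ih =>
      intro hi
      obtain ⟨h1, h2⟩ := ih (by omega)
      have hlt : u i < u (i + 1) := card_index_lt (by omega)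
      refine ⟨by omega, ?_⟩
      rw [sum_range_succ, mul_add]
      nlinarith
  obtain ⟨h1, h2⟩ := key P.j le_rfl
  have hD : u P.j ≤ 2 * P.sideSize := by
    have e1 := le_max_left P.result.left.card P.result.right.card
    have e2 := le_max_right P.result.left.card P.result.right.card
    rw [sideSize]
    rw [card_result_left] at e1 ⊢
    rw [card_result_right] at e1 e2 ⊢
    rw [card_result_left] at e2
    simp only [hu]
    omega
  have hj := P.one_le_length
  have hD1 : 1 ≤ P.sideSize := by omega
  have h3 : 2 * P.boundarySize ≤ u P.j * (u P.j + 1) := h2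
  have h4 : u P.j * (u P.j + 1) ≤ (2 * P.sideSize) * (2 * P.sideSize + 1) :=
    Nat.mul_le_mul hD (by omega)
  nlinarith

theorem indices_eq : P.indices = (range (P.j + 1)).image (fun i : ℕ => -(i : ℤ)) ∪
    (range (P.j + 1)).image (fun i : ℕ => (i : ℤ)) := by
  ext i
  simp only [mem_indices, mem_union, mem_image, mem_range]
  constructor
  · intro h
    rcases le_total 0 i with h0 | h0
    · exact Or.inr ⟨i.toNat, by omega, by omega⟩
    · exact Or.inl ⟨(-i).toNat, by omega, by omega⟩
  · rintro (⟨l, hl, rfl⟩ | ⟨l, hl, rfl⟩) <;> omega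

/-- Each index set is `left (-l)` or `right l` for some `0 ≤ l ≤ j`. -/
theorem exists_left_eq {i : ℤ} (hi : i ∈ P.indices) : ∃ l ∈ range (P.j + 1),
    (P.shape i).left = (P.shape (-(l : ℤ))).left ∨ (P.shape i).left = (P.shape (l : ℤ)).right := by
  rcases le_or_gt i 0 with h | h
  · refine ⟨(-i).toNat, ?_, Or.inl ?_⟩
    · rw [mem_indices] at hi; rw [mem_range]; omega
    · rw [show -(((-i).toNat : ℕ) : ℤ) = i by omega]
  · refine ⟨(i - 1).toNat, ?_, Or.inr ?_⟩
    · rw [mem_indices] at hi; rw [mem_range]; omega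
    · rw [show (((i - 1).toNat : ℕ) : ℤ) = i - 1 by omega]
      exact (left_eq_right hi (by omega)).2

theorem exists_right_eq {i : ℤ} (hi : i ∈ P.indices) : ∃ l ∈ range (P.j + 1),
    (P.shape i).right = (P.shape (-(l : ℤ))).left ∨
      (P.shape i).right = (P.shape (l : ℤ)).right := by
  rcases le_or_gt 0 i with h | h
  · refine ⟨i.toNat, ?_, Or.inr ?_⟩
    · rw [mem_indices] at hi; rw [mem_range]; omega
    · rw [show ((i.toNat : ℕ) : ℤ) = i by omega]
  · obtain ⟨h1, h2⟩ := right_eq_left hi (by omega)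
    rw [h2]
    obtain ⟨l, hl, h3 | h3⟩ := exists_left_eq h1
    exacts [⟨l, hl, Or.inl h3⟩, ⟨l, hl, Or.inr h3⟩]

theorem card_squares_le :
    P.squares.card ≤ ∑ i ∈ P.indices, (P.shape i).middleSquares.card + P.boundarySize := by
  have hsub : P.squares ⊆ (P.indices.biUnion fun i => (P.shape i).middleSquares) ∪
      (range (P.j + 1)).biUnion fun i => (P.shape (-(i : ℤ))).left ∪ (P.shape i).right := by
    intro s hs
    obtain ⟨i, hi, hs⟩ := mem_squares.1 hs
    rw [mem_union, mem_biUnion, mem_biUnion]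
    by_cases hl : s ∈ (P.shape i).left
    · obtain ⟨l, hl', h | h⟩ := exists_left_eq hi
      · exact Or.inr ⟨l, hl', mem_union_left _ (h ▸ hl)⟩
      · exact Or.inr ⟨l, hl', mem_union_right _ (h ▸ hl)⟩
    by_cases hr : s ∈ (P.shape i).right
    · obtain ⟨l, hl', h | h⟩ := exists_right_eq hi
      · exact Or.inr ⟨l, hl', mem_union_left _ (h ▸ hr)⟩
      · exact Or.inr ⟨l, hl', mem_union_right _ (h ▸ hr)⟩
    exact Or.inl ⟨i, hi, by simp [middleSquares, hs, hl, hr]⟩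
  refine (card_le_card hsub).trans ((card_union_le _ _).trans ?_)
  exact add_le_add card_biUnion_le (card_biUnion_le.trans (sum_le_sum fun i _ => card_union_le _ _))

theorem sum_index_le :
    ∑ i ∈ P.indices, ((P.shape i).left.card + (P.shape i).right.card) ≤ 2 * P.boundarySize := by
  have hneg : ∀ i : ℕ, i ≤ P.j → (P.shape (-(i : ℤ))).right.card ≤ (P.shape (-(i : ℤ))).left.card := by
    intro i hi
    rcases Nat.eq_zero_or_pos i with rfl | h
    · exact P.isMiddle.2.2 _ P.isMiddle.1.1
    · exact (P.isLeft _ (Finset.mem_Icc.2 (by omega))).card_right_le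
  have hpos : ∀ i : ℕ, i ≤ P.j → (P.shape (i : ℤ)).left.card ≤ (P.shape (i : ℤ)).right.card := by
    intro i hi
    rcases Nat.eq_zero_or_pos i with rfl | h
    · exact P.isMiddle.1.2 _ P.isMiddle.2.1
    · exact (P.isRight _ (Finset.mem_Icc.2 (by omega))).card_right_le
  have h1 : ∑ i ∈ P.indices, ((P.shape i).left.card + (P.shape i).right.card) ≤
      ∑ i ∈ range (P.j + 1), ((P.shape (-(i : ℤ))).left.card + (P.shape (-(i : ℤ))).right.card) +
      ∑ i ∈ range (P.j + 1), ((P.shape (i : ℤ)).left.card + (P.shape (i : ℤ)).right.card) := by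
    -- The middle shape is in both images; counting it twice only weakens the bound.
    rw [indices_eq]
    have := sum_union_inter (s₁ := (range (P.j + 1)).image (fun i : ℕ => -(i : ℤ)))
      (s₂ := (range (P.j + 1)).image (fun i : ℕ => (i : ℤ)))
      (f := fun i => (P.shape i).left.card + (P.shape i).right.card)
    rw [sum_image fun a _ b _ h => by simpa using h,
      sum_image fun a _ b _ h => by simpa using h] at this
    omega
  rw [← sum_add_distrib] at h1
  refine h1.trans ?_
  rw [boundarySize, mul_sum]
  refine sum_le_sum fun i hi => ?_
  have hi' := mem_range.1 hi
  have := hneg i (by omega)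
  have := hpos i (by omega)
  omega

theorem two_mul_card_circles_le (hk : 2 ≤ k) :
    2 * P.circles.card ≤ ∑ i ∈ P.indices, (P.shape i).edgeWeight := by
  have h : P.circles.card ≤ ∑ i ∈ P.indices, (P.shape i).circles.card := card_biUnion_le
  refine (Nat.mul_le_mul_left 2 h).trans ?_
  rw [mul_sum]
  refine sum_le_sum fun i hi => ?_
  rw [← sum_circleDegree, mul_comm, ← smul_eq_mul]
  exact card_nsmul_le_sum _ _ _ fun c hc => hk.trans (P.le_circleDegree i hi c hc)

/-- Let `T` be the sum on the right and `B` the boundary size. There are at most `T/2 + B` squares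
and at most `E/2` circles, and `E ≤ T + 2B`. The total is thus at most `2T + 4B`, and `B ≤ 3D²`
gives the constant `12`. -/
theorem totalSize_le (hk : 2 ≤ k) : P.totalSize ≤
    2 * ∑ i ∈ P.indices, (2 * (P.shape i).middleSquares.card + (P.shape i).degreeExcess) +
      12 * P.sideSize ^ 2 := by
  have h1 := card_squares_le (P := P)
  have h2 := sum_index_le (P := P)
  have h3 := two_mul_card_circles_le (P := P) hk
  have h4 := boundarySize_le (P := P)
  have h5 : ∑ i ∈ P.indices, (P.shape i).edgeWeight ≤
      ∑ i ∈ P.indices, (2 * (P.shape i).middleSquares.card + (P.shape i).degreeExcess) +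
        ∑ i ∈ P.indices, ((P.shape i).left.card + (P.shape i).right.card) := by
    rw [← sum_add_distrib]
    refine sum_le_sum fun i hi => ?_
    have e := edgeWeight_add_eq (P.two_le_totalDegree i hi)
    have e' : (P.shape i).squares.card ≤ (P.shape i).middleSquares.card +
        ((P.shape i).left.card + (P.shape i).right.card) := by
      rw [middleSquares]
      have a := card_union_le (P.shape i).left (P.shape i).right
      have b := card_sdiff_add_card_eq_card
        (union_subset (P.shape i).left_subset (P.shape i).right_subset)
      omega
    omega
  rw [sum_add_distrib, ← mul_sum] at h5 ⊢
  rw [totalSize]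
  omega

end IntersectionConfiguration

/-! ### The equality case of the colouring bound -/

namespace Shape

variable {Sq Ci : Type}

/-- If the colouring bound is attained, then the colour classes are the differences of the indices,
which cover all squares, and all total degrees equal `2`. -/
theorem tight_structure {α : Shape Sq Ci} {A A' : Finset Sq}
    (hA : A ⊆ α.squares) (hA' : A' ⊆ α.squares) (hAA : Disjoint A A')
    (hdeg : ∀ s ∈ α.squares, 2 ≤ α.squareTotalDegree s)
    (hleft : Disjoint α.left A') (hright : Disjoint α.right A)
    (hE : α.edgeWeight ≤ A.card + A'.card) :
    (∀ s ∈ α.squares, s ∈ α.left ∨ s ∈ α.right) ∧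
      (∀ s ∈ α.squares, α.squareTotalDegree s = 2) ∧
      (∀ s ∈ α.left, s ∉ α.right → s ∈ A) ∧ ∀ s ∈ α.right, s ∉ α.left → s ∈ A' := by
  classical
  have h := two_mul_middle_add_excess_le hA hA' hAA hdeg hleft hright
  have hmid : α.middleSquares = ∅ := card_eq_zero.1 (by omega)
  have hex : α.degreeExcess = 0 := by omega
  have hcov : ∀ s ∈ α.squares, s ∈ α.left ∨ s ∈ α.right := fun s hs => by
    by_contra hcon
    have : s ∈ α.middleSquares := by simpa [middleSquares, hs] using hcon
    simp [hmid] at this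
  have hsq : α.squares = α.left ∪ α.right :=
    Finset.Subset.antisymm (fun s hs => mem_union.2 (hcov s hs))
      (union_subset α.left_subset α.right_subset)
  have e := edgeWeight_add_eq hdeg
  have h1 : A ⊆ α.left \ α.right := fun s hs => by
    have hr := Finset.disjoint_right.1 hright hs
    exact mem_sdiff.2 ⟨(hcov s (hA hs)).resolve_right hr, hr⟩
  have h2 : A' ⊆ α.right \ α.left := fun s hs => by
    have hr := Finset.disjoint_right.1 hleft hs
    exact mem_sdiff.2 ⟨(hcov s (hA' hs)).resolve_left hr, hr⟩
  have c1 := card_le_card h1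
  have c2 := card_le_card h2
  have u1 : (α.left ∪ α.right).card = (α.left \ α.right).card + α.right.card := by
    rw [← sdiff_union_self_eq_union, card_union_of_disjoint sdiff_disjoint]
  have u2 : (α.left ∪ α.right).card = (α.right \ α.left).card + α.left.card := by
    rw [union_comm, ← sdiff_union_self_eq_union, card_union_of_disjoint sdiff_disjoint]
  rw [hsq] at e
  have a1 := eq_of_subset_of_card_le h1 (by omega)
  have a2 := eq_of_subset_of_card_le h2 (by omega)
  refine ⟨hcov, fun s hs => ?_, fun s hs hr => ?_, fun s hs hl => ?_⟩
  · have := Finset.sum_eq_zero_iff.1 hex s hs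
    have := hdeg s hs
    omega
  · rw [a1]; exact mem_sdiff.2 ⟨hs, hr⟩
  · rw [a2]; exact mem_sdiff.2 ⟨hs, hl⟩

end Shape

namespace IntersectionConfiguration

open Shape

variable {k : ℕ} {P : IntersectionConfiguration k}
  {S : Finset (P.SquareClass ⊕ P.CircleClass)}

/-! ### Well-behaved configurations -/

/-- By `tight_structure`, a square in exactly one index of a shape is coloured and has one edge, and
a square in both has none. The positions of the coloured copies then determine all coincidences of
squares. -/
theorem isWellBehaved_of_tight (hk : 0 < k) (hsep : P.result.IsVertexSeparator S)
    (htight : ∀ i ∈ P.indices, (P.shape i).edgeWeight ≤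
      (P.leftColor S i).toLeft.card + (P.rightColor S i).toLeft.card) : P.IsWellBehaved := by
  classical
  have hstr := fun i (hi : i ∈ P.indices) =>
    tight_structure (leftColor_toLeft_subset (S := S) i)
    (rightColor_toLeft_subset (S := S) i) (disjoint_color_toLeft hk hi)
    (P.two_le_totalDegree i hi)
    (Finset.disjoint_left.2 fun s hs h =>
      notMem_rightColor_of_mem_left hi hs (mem_toLeft.1 h))
    (Finset.disjoint_left.2 fun s hs h =>
      notMem_leftColor_of_mem_right hsep hi hs (mem_toLeft.1 h)) (htight i hi)
  have hboth : ∀ i ∈ P.indices, ∀ s, s ∈ (P.shape i).left → s ∈ (P.shape i).right →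
      (P.shape i).squareDegree s = 0 := fun i hi s hl hr => by
    have := (hstr i hi).2.1 s ((P.shape i).left_subset hl)
    rw [squareTotalDegree, if_pos hl, if_pos hr] at this
    omega
  have hone : ∀ i ∈ P.indices, ∀ s ∈ (P.shape i).squares,
      ¬ (s ∈ (P.shape i).left ∧ s ∈ (P.shape i).right) → (P.shape i).squareDegree s = 1 := by
    intro i hi s hs hnot
    have h2 := (hstr i hi).2.1 s hs
    rw [squareTotalDegree] at h2
    rcases (hstr i hi).1 s hs with h | h
    · rw [if_pos h, if_neg fun h' => hnot ⟨h, h'⟩] at h2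
      omega
    · rw [if_pos h, if_neg fun h' => hnot ⟨h', h⟩] at h2
      omega
  -- In the last shape that contains `s`, either `s` is outside the right index and so
  -- left-coloured, or this shape is the final one.
  have hL : ∀ s ∈ P.squares, s ∈ (P.shape (P.j : ℤ)).right ∨
      ∃ i ∈ P.indices, Sum.inl s ∈ P.leftColor S i := by
    intro s hs
    obtain ⟨i₀, hi₀, hs₀⟩ := mem_squares.1 hs
    obtain ⟨i, hi, hmax⟩ := exists_max_image (P.indices.filter fun i => s ∈ (P.shape i).squares)
      id ⟨i₀, mem_filter.2 ⟨hi₀, hs₀⟩⟩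
    rw [mem_filter] at hi
    by_cases hr : s ∈ (P.shape i).right
    · by_cases hij : i = P.j
      · exact Or.inl (hij ▸ hr)
      · obtain ⟨h1, h2⟩ := right_eq_left hi.1 hij
        have := hmax (i + 1) (mem_filter.2 ⟨h1, (P.shape _).left_subset (h2 ▸ hr)⟩)
        simp only [id] at this
        omega
    · exact Or.inr ⟨i, hi.1, mem_toLeft.1
        ((hstr i hi.1).2.2.1 s (((hstr i hi.1).1 s hi.2).resolve_right hr) hr)⟩
  have hR : ∀ s ∈ P.squares, s ∈ (P.shape (-(P.j : ℤ))).left ∨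
      ∃ i ∈ P.indices, Sum.inl s ∈ P.rightColor S i := by
    intro s hs
    obtain ⟨i₀, hi₀, hs₀⟩ := mem_squares.1 hs
    obtain ⟨i, hi, hmin⟩ := exists_min_image (P.indices.filter fun i => s ∈ (P.shape i).squares)
      id ⟨i₀, mem_filter.2 ⟨hi₀, hs₀⟩⟩
    rw [mem_filter] at hi
    by_cases hl : s ∈ (P.shape i).left
    · by_cases hij : i = -(P.j : ℤ)
      · exact Or.inl (hij ▸ hl)
      · obtain ⟨h1, h2⟩ := left_eq_right hi.1 hij
        have := hmin (i - 1) (mem_filter.2 ⟨h1, (P.shape _).right_subset (h2 ▸ hl)⟩)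
        simp only [id] at this
        omega
    · exact Or.inr ⟨i, hi.1, mem_toLeft.1
        ((hstr i hi.1).2.2.2 s (((hstr i hi.1).1 s hi.2).resolve_left hl) hl)⟩
  have hj : (P.j : ℤ) ∈ P.indices := mem_indices.2 (by omega)
  have hsame : ∀ i ∈ P.indices, ∀ s ∈ (P.shape i).squares, ∀ s' ∈ (P.shape i).squares,
      P.equiv (Sum.inl s) (Sum.inl s') → s = s' := fun i hi s hs s' hs' h =>
    Sum.inl.inj (P.trivial_on_shapes i hi _ (inl_mem_vertices.2 hs) _ (inl_mem_vertices.2 hs') h)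
  have hlast : ∀ s s', P.equiv (Sum.inl s) (Sum.inl s') → s ∈ (P.shape (P.j : ℤ)).right →
      ∀ i ∈ P.indices, Sum.inl s' ∈ P.leftColor S i → s = s' := by
    intro s s' h hs i hi hs'
    have hs0 := (P.shape _).right_subset hs
    rw [mem_leftColor] at hs'
    have h1 := hs'.2.2 P.j hj (Sum.inl s) (inl_mem_vertices.2 hs0) (vertexClass_eq_iff.2 h)
    have h2 : i = P.j := le_antisymm (mem_indices.1 hi).2 h1
    exact hsame _ hj s hs0 s' (h2 ▸ inl_mem_vertices.1 hs'.1) h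
  -- Equivalent squares have their rightmost copies in the same shape, where equivalence is trivial.
  have hinj : ∀ s ∈ P.squares, ∀ s' ∈ P.squares, P.equiv (Sum.inl s) (Sum.inl s') → s = s' := by
    intro s hs s' hs' h
    rcases hL s hs with h1 | ⟨i, hi, h1⟩
    · rcases hL s' hs' with h2 | ⟨i', hi', h2⟩
      · exact hsame _ hj s ((P.shape _).right_subset h1) s' ((P.shape _).right_subset h2) h
      · exact hlast s s' h h1 i' hi' h2
    · rcases hL s' hs' with h2 | ⟨i', hi', h2⟩
      · exact (hlast s' s (P.equiv.symm h) h2 i hi h1).symm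
      · rw [mem_leftColor] at h1 h2
        have e := le_antisymm (h2.2.2 i hi _ h1.1 (vertexClass_eq_iff.2 h))
          (h1.2.2 i' hi' _ h2.1 (vertexClass_eq_iff.2 (P.equiv.symm h)))
        subst e
        exact hsame i hi s (inl_mem_vertices.1 h1.1) s' (inl_mem_vertices.1 h2.1) h
  refine ⟨fun i hi => isSSD_of_squareDegree (hstr i hi).1 (hboth i hi) (hone i hi), hinj, ?_⟩
  intro s hs hsl hsr
  obtain ⟨b, hb, hsb⟩ := (hL s hs).resolve_left fun h => hsr (mem_result_right.2 ⟨s, h, rfl⟩)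
  obtain ⟨a, ha, hsa⟩ := (hR s hs).resolve_left fun h => hsl (mem_result_left.2 ⟨s, h, rfl⟩)
  have hab : a ≠ b := by
    rintro rfl
    exact Finset.disjoint_left.1 (disjoint_leftColor_rightColor hk ha) hsb hsa
  have hda := hone a ha s (inl_mem_vertices.1 (mem_rightColor.1 hsa).1)
    fun h => notMem_rightColor_of_mem_left ha h.1 hsa
  have hdb := hone b hb s (inl_mem_vertices.1 (mem_leftColor.1 hsb).1)
    fun h => notMem_leftColor_of_mem_right hsep hb h.2 hsb
  rw [mem_leftColor] at hsb
  rw [mem_rightColor] at hsa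
  have huniq : ∀ i, (P.shape i).squareDegree s = 1 → ∃ c, (P.shape i).label s c ≠ 0 ∧
      ∀ d, (P.shape i).label s d ≠ 0 → d = c := by
    intro i hd
    obtain ⟨c, hc, h0⟩ := exists_ne_zero_of_sum_ne_zero (hd.trans_ne one_ne_zero)
    refine ⟨c, h0, fun d hd0 => ?_⟩
    by_contra hne
    rw [squareDegree, ← add_sum_erase _ _ hc] at hd
    have := single_le_sum (f := fun c => (P.shape i).label s c) (fun _ _ => Nat.zero_le _)
      (mem_erase.2 ⟨hne, ((P.shape i).mem_of_label_ne_zero s d hd0).2⟩)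
    omega
  obtain ⟨u, hu, hu'⟩ := huniq a hda
  obtain ⟨v, hv, hv'⟩ := huniq b hdb
  have huv : u ≠ v := by
    rintro rfl
    exact hab (eq_of_mem_circles ha hb ((P.shape a).mem_of_label_ne_zero s u hu).2
      ((P.shape b).mem_of_label_ne_zero s u hv).2)
  have hnb : P.neighbors s = {u, v} := by
    ext c
    simp only [neighbors, Set.mem_ofPred_eq, Set.mem_insert_iff, Set.mem_singleton_iff]
    constructor
    · rintro ⟨i, hi, hc⟩
      have hsi := ((P.shape i).mem_of_label_ne_zero s c hc).1
      have h1 := hsb.2.2 i hi (Sum.inl s) (inl_mem_vertices.2 hsi) rfl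
      have h2 := hsa.2.2 i hi (Sum.inl s) (inl_mem_vertices.2 hsi) rfl
      rcases h1.eq_or_lt with rfl | h1
      · exact Or.inr (hv' c hc)
      rcases h2.eq_or_lt with rfl | h2
      · exact Or.inl (hu' c hc)
      -- Strictly between shapes `a` and `b` the square lies in both indices and has degree `0`.
      have hl := mem_left_of_lt ha hi h2 (inl_mem_vertices.1 hsa.1) hsi
      have hr := mem_right_of_lt hi hb h1 hsi (inl_mem_vertices.1 hsb.1)
      exact absurd (squareDegree_eq_zero_iff.1 (hboth i hi s hl hr) c) hc
    · rintro (rfl | rfl)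
      exacts [⟨a, ha, hu⟩, ⟨b, hb, hv⟩]
  -- The class of `s` has representatives of both colours, hence lies on both sides of `S`.
  have hiso := mem_isolated_result.1 (mem_isolated_of_mem_sides hsb.2.1 hsa.2.1)
  have hlab : ∀ r, P.result.label (P.squareClass s) r = 0 := fun r => by
    have := hiso.2.2.2 (Sum.inr r)
    simpa using this
  refine ⟨u, v, huv, hnb, ?_, hlab _⟩
  -- If `u` and `v` were inequivalent, the edge from `s` to `v` would be alone between its classes
  -- and would survive.
  by_contra hne
  refine hv ((result_label_eq_of_unique hb (inl_mem_vertices.1 hsb.1)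
    ((P.shape b).mem_of_label_ne_zero s v hv).2 ?_).symm.trans (hlab _))
  intro i hi hib s' c' h0 h1 h2
  have hsc := (P.shape i).mem_of_label_ne_zero s' c' h0
  have hss : s' = s := hinj s' (mem_squares.2 ⟨i, hi, hsc.1⟩) s hs (squareClass_eq_iff.1 h1)
  subst hss
  have hc' : c' ∈ P.neighbors s' := ⟨i, hi, h0⟩
  rw [hnb] at hc'
  rcases hc' with rfl | rfl
  · exact hne (circleClass_eq_iff.1 h2)
  · exact hib (eq_of_mem_circles hi hb hsc.2 ((P.shape b).mem_of_label_ne_zero s' c' hv).2)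

theorem IsWellBehaved.isolated (h : P.IsWellBehaved) {q : P.SquareClass}
    (hq : q ∈ P.result.squares) (hl : q ∉ P.result.left) (hr : q ∉ P.result.right) :
    Sum.inl q ∈ P.result.isolated := by
  obtain ⟨-, hinj, hnb⟩ := h
  obtain ⟨i, hi, x, hx, hxq⟩ := mem_result_vertices.1 (inl_mem_vertices.2 hq)
  refine mem_isolated_result.2 ⟨inl_mem_vertices.2 hq, by simpa using hl, by simpa using hr, ?_⟩
  rcases x with s | c
  · obtain rfl : P.squareClass s = q := by simpa using hxq
    have hs : s ∈ P.squares := mem_squares.2 ⟨i, hi, inl_mem_vertices.1 hx⟩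
    obtain ⟨u, u', -, hN, huu, h0⟩ := hnb s hs hl hr
    rintro (t | r) hadj
    · simp at hadj
    rw [graph_adj_inl_inr] at hadj
    obtain ⟨i', hi', s', c', hlab, hs', rfl⟩ := exists_label_ne_zero_of_result hadj
    have hsc := (P.shape i').mem_of_label_ne_zero s' c' hlab
    have hss : s' = s := hinj s' (mem_squares.2 ⟨i', hi', hsc.1⟩) s hs (squareClass_eq_iff.1 hs')
    subst hss
    have hc' : c' ∈ P.neighbors s' := ⟨i', hi', hlab⟩
    rw [hN] at hc'
    rcases hc' with rfl | rfl
    · exact hadj h0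
    · rw [← circleClass_eq_iff.2 huu] at hadj
      exact hadj h0
  · simp at hxq

/-- A square of an SSD has degree at most the number of indices it misses. A square misses the right
index only in the last shape containing it and the left index only in the first, so each class is
charged at most once for either side. -/
theorem IsWellBehaved.sum_edgeWeight_le (h : P.IsWellBehaved) :
    ∑ i ∈ P.indices, (P.shape i).edgeWeight + P.result.left.card + P.result.right.card ≤
      2 * P.result.squares.card := by
  classical
  obtain ⟨hssd, hinj, -⟩ := h
  have hmem : ∀ i ∈ P.indices, ∀ s ∈ (P.shape i).squares, P.squareClass s ∈ P.result.squares :=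
    fun i hi s hs => inl_mem_vertices.1
      (mem_result_vertices.2 ⟨i, hi, Sum.inl s, inl_mem_vertices.2 hs, rfl⟩)
  have hE : ∀ i ∈ P.indices, (P.shape i).edgeWeight ≤
      ((P.shape i).squares \ (P.shape i).right).card +
        ((P.shape i).squares \ (P.shape i).left).card := by
    intro i hi
    rw [← sum_squareDegree, ← filter_notMem_eq_sdiff, ← filter_notMem_eq_sdiff, card_filter,
      card_filter, ← sum_add_distrib]
    refine sum_le_sum fun s hs => ((hssd i hi).squareDegree_le hs).trans ?_
    by_cases h1 : s ∈ (P.shape i).left <;> by_cases h2 : s ∈ (P.shape i).right <;> simp [h1, h2]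
  have hR : ∑ i ∈ P.indices, ((P.shape i).squares \ (P.shape i).right).card ≤
      (P.result.squares \ P.result.right).card := by
    rw [← card_sigma]
    refine card_le_card_of_injOn (fun z => P.squareClass z.2) ?_ ?_
    · rintro ⟨i, s⟩ hz
      simp only [coe_sigma, Set.mem_sigma_iff, mem_coe, mem_sdiff] at hz
      obtain ⟨hi, hs, hr⟩ := hz
      refine mem_coe.2 (mem_sdiff.2 ⟨hmem i hi s hs, fun h => ?_⟩)
      obtain ⟨t, ht, hts⟩ := mem_result_right.1 h
      have hj : (P.j : ℤ) ∈ P.indices := mem_indices.2 (by omega)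
      have ht' := (P.shape _).right_subset ht
      have hts' := hinj t (mem_squares.2 ⟨_, hj, ht'⟩) s (mem_squares.2 ⟨i, hi, hs⟩)
        (squareClass_eq_iff.1 hts)
      subst hts'
      rcases (mem_indices.1 hi).2.eq_or_lt with h | h
      · exact hr (h ▸ ht)
      · exact hr (mem_right_of_lt hi hj h hs ht')
    · rintro ⟨i, s⟩ hz ⟨i', s'⟩ hz' h
      simp only [coe_sigma, Set.mem_sigma_iff, mem_coe, mem_sdiff] at hz hz'
      have hss := hinj s (mem_squares.2 ⟨i, hz.1, hz.2.1⟩) s' (mem_squares.2 ⟨i', hz'.1, hz'.2.1⟩)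
        (squareClass_eq_iff.1 h)
      subst hss
      rcases lt_trichotomy i i' with h | rfl | h
      · exact absurd (mem_right_of_lt hz.1 hz'.1 h hz.2.1 hz'.2.1) hz.2.2
      · rfl
      · exact absurd (mem_right_of_lt hz'.1 hz.1 h hz'.2.1 hz.2.1) hz'.2.2
  have hL : ∑ i ∈ P.indices, ((P.shape i).squares \ (P.shape i).left).card ≤
      (P.result.squares \ P.result.left).card := by
    rw [← card_sigma]
    refine card_le_card_of_injOn (fun z => P.squareClass z.2) ?_ ?_
    · rintro ⟨i, s⟩ hz
      simp only [coe_sigma, Set.mem_sigma_iff, mem_coe, mem_sdiff] at hz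
      obtain ⟨hi, hs, hr⟩ := hz
      refine mem_coe.2 (mem_sdiff.2 ⟨hmem i hi s hs, fun h => ?_⟩)
      obtain ⟨t, ht, hts⟩ := mem_result_left.1 h
      have hj : -(P.j : ℤ) ∈ P.indices := mem_indices.2 (by omega)
      have ht' := (P.shape _).left_subset ht
      have hts' := hinj t (mem_squares.2 ⟨_, hj, ht'⟩) s (mem_squares.2 ⟨i, hi, hs⟩)
        (squareClass_eq_iff.1 hts)
      subst hts'
      rcases (mem_indices.1 hi).1.eq_or_lt with h | h
      · exact hr (h ▸ ht)
      · exact hr (mem_left_of_lt hj hi h ht' hs)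
    · rintro ⟨i, s⟩ hz ⟨i', s'⟩ hz' h
      simp only [coe_sigma, Set.mem_sigma_iff, mem_coe, mem_sdiff] at hz hz'
      have hss := hinj s (mem_squares.2 ⟨i, hz.1, hz.2.1⟩) s' (mem_squares.2 ⟨i', hz'.1, hz'.2.1⟩)
        (squareClass_eq_iff.1 h)
      subst hss
      rcases lt_trichotomy i i' with h | rfl | h
      · exact absurd (mem_left_of_lt hz.1 hz'.1 h hz.2.1 hz'.2.1) hz'.2.2
      · rfl
      · exact absurd (mem_left_of_lt hz'.1 hz.1 h hz'.2.1 hz.2.1) hz.2.2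
  have h1 := card_sdiff_add_card_eq_card P.result.right_subset
  have h2 := card_sdiff_add_card_eq_card P.result.left_subset
  have h3 := sum_le_sum hE
  rw [sum_add_distrib] at h3
  omega

/-- All circles together with the squares of `U ∩ V` form a separator, since a path of positive
length from `U` has a circle as its second vertex. The circle weights then cancel, and the squares
outside `U ∪ V` count twice because they are isolated. -/
theorem IsWellBehaved.edgeWeight_add_weight_le (h : P.IsWellBehaved) {n m : ℕ}
    (hω : 0 ≤ Real.logb n m) (hS : IsMinWeightSeparator n m P.result S) :
    ((∑ i ∈ P.indices, (P.shape i).edgeWeight : ℕ) : ℝ) + weight n m S ≤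
      weight n m P.result.vertices + weight n m P.result.isolated := by
  classical
  have hsub : P.result.left ∩ P.result.right ⊆ P.result.squares :=
    inter_subset_left.trans P.result.left_subset
  have hsep : P.result.IsVertexSeparator
      ((P.result.left ∩ P.result.right).disjSum P.result.circles) := by
    refine ⟨disjSum_mono hsub subset_rfl, ?_⟩
    rintro _ ⟨q, hq, rfl⟩ _ ⟨q', hq', rfl⟩ p -
    by_cases hqr : q ∈ P.result.right
    · exact ⟨_, p.start_mem_support, by simpa using ⟨hq, hqr⟩⟩
    · cases p with
      | nil => exact absurd hq' hqr
      | cons hadj p =>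
        rename_i w
        rcases w with t | r
        · simp at hadj
        · exact ⟨Sum.inr r, by simp, by simpa using
            (P.result.mem_of_label_ne_zero q r (by simpa using hadj)).2⟩
  have h1 := hS.2 _ hsep
  have hI : (P.result.squares \ (P.result.left ∪ P.result.right)).disjSum ∅ ⊆
      P.result.isolated := by
    rintro (q | r) hx
    · rw [inl_mem_disjSum, mem_sdiff, mem_union, not_or] at hx
      exact h.isolated hx.1 hx.2.1 hx.2.2
    · simp at hx
  have h2 := weight_mono hω hI
  have h3 := h.sum_edgeWeight_le
  have h4 := card_union_add_card_inter P.result.left P.result.right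
  have h5 := card_sdiff_add_card_eq_card (union_subset P.result.left_subset P.result.right_subset)
  have h6 : (∑ i ∈ P.indices, (P.shape i).edgeWeight) +
      (P.result.left ∩ P.result.right).card ≤ P.result.squares.card +
        (P.result.squares \ (P.result.left ∪ P.result.right)).card := by omega
  have h7 : ((∑ i ∈ P.indices, (P.shape i).edgeWeight : ℕ) : ℝ) +
      (P.result.left ∩ P.result.right).card ≤ P.result.squares.card +
        (P.result.squares \ (P.result.left ∪ P.result.right)).card := by exact_mod_cast h6
  rw [weight_eq, weight_eq, toLeft_disjSum, toRight_disjSum] at h1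
  rw [weight_eq, toLeft_disjSum, toRight_disjSum, card_empty] at h2
  rw [weight_eq n m P.result.vertices, Shape.vertices, toLeft_disjSum, toRight_disjSum]
  rw [weight_eq n m S]
  push_cast at *
  linarith

/-! ### The norm bound -/

variable (P S) in
/-- Twice the difference between the number of edges and the number of coloured squares. -/
noncomputable def slack : ℕ :=
  ∑ i ∈ P.indices, (2 * (P.shape i).edgeWeight -
    2 * ((P.leftColor S i).toLeft.card + (P.rightColor S i).toLeft.card))

theorem sum_edgeWeight_eq (hk : 0 < k) (hsep : P.result.IsVertexSeparator S) :
    2 * ∑ i ∈ P.indices, (P.shape i).edgeWeight = P.slack S +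
      2 * ∑ i ∈ P.indices, ((P.leftColor S i).toLeft.card + (P.rightColor S i).toLeft.card) := by
  rw [slack, mul_sum, mul_sum, ← sum_add_distrib]
  refine sum_congr rfl fun i hi => ?_
  have := color_add_circles_le hk hsep hi
  omega

theorem mul_circles_le_slack (hk : 0 < k) (hsep : P.result.IsVertexSeparator S) :
    k * ∑ i ∈ P.indices, ((P.leftColor S i).toRight.card + (P.rightColor S i).toRight.card) ≤
      P.slack S := by
  rw [slack, mul_sum]
  refine sum_le_sum fun i hi => ?_
  have := color_add_circles_le hk hsep hi
  omega

theorem totalSize_le_slack (hk : 2 ≤ k) (hsep : P.result.IsVertexSeparator S) :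
    P.totalSize ≤ 2 * P.slack S + 12 * P.sideSize ^ 2 := by
  refine (totalSize_le hk).trans (Nat.add_le_add_right (Nat.mul_le_mul_left 2 ?_) _)
  refine sum_le_sum fun i hi => ?_
  have := color_add_middle_le (by omega) hsep hi
  omega

theorem isWellBehaved_of_slack_eq_zero (hk : 0 < k) (hsep : P.result.IsVertexSeparator S)
    (h : P.slack S = 0) : P.IsWellBehaved := by
  refine isWellBehaved_of_tight hk hsep fun i hi => ?_
  have := Finset.sum_eq_zero_iff.1 h i hi
  omega

/-- With `a` coloured squares and `c` coloured circles, `2(a + ωc) ≤ 2a + (1 - ε)kc ≤ 2a + (1 - ε) *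
slack = 2E - ε * slack`. -/
theorem weight_add_slack_le {n m : ℕ} {ε : ℝ} (hk : 0 < k) (hω : 0 ≤ Real.logb n m)
    (hωk : 2 * Real.logb n m ≤ (1 - ε) * k) (hsep : P.result.IsVertexSeparator S) :
    2 * (weight n m P.result.vertices + weight n m P.result.isolated - weight n m S) +
      ε * P.slack S ≤ 2 * ((∑ i ∈ P.indices, (P.shape i).edgeWeight : ℕ) : ℝ) := by
  have h1 := weight_le_weight_sides hω hsep.1
  have h2 := weight_le_sum_extremal hω (fun i => i) (K := P.leftSide S)
    fun ξ hξ => (mem_leftSide.1 hξ).1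
  have h3 := weight_le_sum_extremal hω (fun i => -i) (K := P.rightSide S)
    fun ξ hξ => (mem_rightSide.1 hξ).1
  set a := ∑ i ∈ P.indices, ((P.leftColor S i).toLeft.card + (P.rightColor S i).toLeft.card)
    with ha
  set c := ∑ i ∈ P.indices, ((P.leftColor S i).toRight.card + (P.rightColor S i).toRight.card)
    with hc
  have h4 : ∑ i ∈ P.indices, weight n m (P.extremal (fun i => i) (P.leftSide S) i) +
      ∑ i ∈ P.indices, weight n m (P.extremal (fun i => -i) (P.rightSide S) i) =
      a + Real.logb n m * c := by
    rw [ha, hc]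
    push_cast
    rw [mul_sum, ← sum_add_distrib, ← sum_add_distrib]
    refine sum_congr rfl fun i _ => ?_
    rw [weight_eq, weight_eq, leftColor, rightColor]
    ring
  have h5 : (2 : ℝ) * ((∑ i ∈ P.indices, (P.shape i).edgeWeight : ℕ) : ℝ) =
      P.slack S + 2 * (a : ℝ) := by exact_mod_cast sum_edgeWeight_eq hk hsep
  have h6 : (k : ℝ) * c ≤ P.slack S := by exact_mod_cast mul_circles_le_slack hk hsep
  have h7 : 2 * Real.logb n m * c ≤ (1 - ε) * k * c :=
    mul_le_mul_of_nonneg_right hωk (Nat.cast_nonneg _)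
  have hk' : (0 : ℝ) < k := Nat.cast_pos.2 hk
  have hε : 0 ≤ 1 - ε := by
    by_contra hneg
    nlinarith [mul_neg_of_neg_of_pos (not_le.1 hneg) hk']
  have h8 := mul_le_mul_of_nonneg_left h6 hε
  linarith

theorem scalingCoeff_eq {n : ℕ} (hn : 0 < n) : P.scalingCoeff n =
    (n : ℝ) ^ (-((∑ i ∈ P.indices, (P.shape i).edgeWeight : ℕ) : ℝ) / 2) := by
  rw [scalingCoeff]
  simp only [Shape.scalingCoeff]
  rw [← Real.rpow_sum_of_pos (Nat.cast_pos.2 hn)]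
  congr 1
  push_cast
  rw [← sum_div, sum_neg_distrib]

end IntersectionConfiguration
end GraphMatrix

/-! ### Conclusion: the exponent in terms of the slack -/

theorem mainTheorem3 (n m k : ℕ) (ε : ℝ) (hn : 2 ≤ n) (hm : 1 ≤ m) (hk : 2 ≤ k)
    (hε0 : 0 < ε) (hε1 : ε < 1) (hmn : (m : ℝ) ≤ (n : ℝ) ^ ((1 - ε) * (k : ℝ) / 2))
    (P : GraphMatrix.IntersectionConfiguration k) :
    (P.IsWellBehaved → P.scalingCoeff n * P.result.approxNorm n m = 1) ∧
    (¬ P.IsWellBehaved →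
      P.scalingCoeff n * P.result.approxNorm n m ≤
        (n : ℝ) ^ (-(max (ε / 8)
          (ε / 12 * ((P.totalSize : ℝ) - 12 * (P.sideSize : ℝ) ^ 2))))) := by
  open GraphMatrix IntersectionConfiguration Shape in
  have hn1 : (1 : ℝ) < n := by exact_mod_cast (by omega : 1 < n)
  have hm1 : (1 : ℝ) ≤ m := by exact_mod_cast hm
  have hω : 0 ≤ Real.logb n m := Real.logb_nonneg hn1 hm1
  have hωk : 2 * Real.logb n m ≤ (1 - ε) * k := by
    have := (Real.logb_le_iff_le_rpow hn1 (by linarith)).2 hmn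
    linarith
  have hmin := (exists_isMinWeightSeparator n m P.result).choose_spec
  have hX := weight_add_slack_le (by omega) hω hωk hmin.1
  have hprod : P.scalingCoeff n * P.result.approxNorm n m =
      (n : ℝ) ^ (-((∑ i ∈ P.indices, (P.shape i).edgeWeight : ℕ) : ℝ) / 2 +
        (weight n m P.result.vertices + weight n m P.result.isolated -
          weight n m (minWeightSeparator n m P.result)) / 2) := by
    rw [scalingCoeff_eq (by omega), approxNorm, ← Real.rpow_add (by linarith)]
  set Z := P.slack (minWeightSeparator n m P.result) with hZ
  change _ + ε * (Z : ℝ) ≤ _ at hX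
  have hεZ : 0 ≤ ε * (Z : ℝ) := by positivity
  rw [hprod]
  constructor
  · intro hwb
    have h := hwb.edgeWeight_add_weight_le hω hmin
    -- `h` gives `≥` and `hX`, whose slack term is nonnegative, gives `≤`.
    have h0 : -((∑ i ∈ P.indices, (P.shape i).edgeWeight : ℕ) : ℝ) / 2 +
        (weight n m P.result.vertices + weight n m P.result.isolated -
          weight n m (minWeightSeparator n m P.result)) / 2 = 0 := by
      rw [minWeightSeparator] at *
      linarith
    rw [h0, Real.rpow_zero]
  · intro hwb
    have hZ1 : (1 : ℝ) ≤ Z := by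
      have : Z ≠ 0 := fun h => hwb (isWellBehaved_of_slack_eq_zero (by omega) hmin.1 h)
      exact_mod_cast Nat.one_le_iff_ne_zero.2 this
    have htot : (P.totalSize : ℝ) ≤ 2 * Z + 12 * (P.sideSize : ℝ) ^ 2 := by
      exact_mod_cast totalSize_le_slack hk hmin.1
    -- The first term is covered by `Z ≥ 1`; the second is at most `εZ/6`.
    have hmax : max (ε / 8) (ε / 12 * ((P.totalSize : ℝ) - 12 * (P.sideSize : ℝ) ^ 2)) ≤
        ε * Z / 4 := by
      refine max_le (by nlinarith) ?_
      have : ε / 12 * ((P.totalSize : ℝ) - 12 * (P.sideSize : ℝ) ^ 2) ≤ ε / 12 * (2 * Z) :=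
        mul_le_mul_of_nonneg_left (by linarith) (by positivity)
      linarith
    refine Real.rpow_le_rpow_of_exponent_le hn1.le ?_
    rw [minWeightSeparator] at *
    linarith
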